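/- Let $\Bbbk$ be an algebraically closed field of characteristic $0$, let $n\ge 1$, and let $G=\langle a,b\mid a^{2n}=b^2=1,\ ab=ba\rangle$. Let $g\mapsto g\triangleleft x$ be the automorphism of $G$ with $a\triangleleft x=ab$, $b\triangleleft x=b$. Let $\sigma:G\to\Bbbk^\times$ satisfy $\sigma(1)=1$ and $\sigma(g\triangleleft x)=\sigma(g)$, and let $\tau:G\times G\to\Bbbk^\times$ be a unital $2$-cocycle with $\sigma(gh)\sigma(g)^{-1}\sigma(h)^{-1}=\tau(g,h)\,\tau(g\triangleleft x,h\triangleleft x)$ for all $g,h\in G$. Assume $\tau(a,b)\tau(b,a)^{-1}=-1$. Let $K(8n,\sigma,\tau)=\Bbbk^G\#_{\sigma,\tau}\Bbbk\mathbb Z_2$ be the Hopf algebra with basis $\{e_g,e_gx\}_{g\in G}$ such that $e_ge_h=\delta_{g,h}e_g$, $xe_g=e_{g\triangleleft x}x$, $x^2=\sum_g\sigma(g)e_g$, $1=\sum_g e_g$, $\Delta(e_g)=\sum_{hk=g}e_h\otimes e_k$, $\Delta(x)=\bigl[\sum_{g,h}\tau(g,h)e_g\otimes e_h\bigr](x\otimes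 x)$, $\varepsilon(x)=1$, $\varepsilon(e_g)=\delta_{g,1}$, $\mathcal S(e_g)=e_{g^{-1}}$, $\mathcal S(x)=\sum_g\sigma(g)^{-1}\tau(g,g^{-1})^{-1}e_{g\triangleleft x}x$. A *universal $\mathcal R$-matrix* of a Hopf algebra $H$ is an invertible $R\in H\otimes H$ with $(\Delta\otimes\mathrm{id})(R)=R_{13}R_{23}$, $(\mathrm{id}\otimes\Delta)(R)=R_{13}R_{12}$ and $\Delta^{op}(h)R=R\Delta(h)$ for all $h\in H$. It is a *minimal quasitriangular structure* on $H$ if $H=H_lH_r$, where $H_l=\{(f\otimes\mathrm{id})(R): f\in H^*\}$ and $H_r=\{(\mathrm{id}\otimes f)(R): f\in H^*\}$. Put $P_i=\prod_{k=1}^{i-1}\tau(a,a^k)$ (so $P_0=P_1=1$), $\lambda_{2i,j}=P_{2i}^{-1}\sigma(a^j)^i$, $\lambda_{2i+1,j}=P_{2i+1}^{-1}\sigma(a^j)^i$, and $h(g,g')=\tau(g,g')/\tau(g'\triangleleft x,g\triangleleft x)$. Let $\alpha,\beta\in\Bbbk$ satisfy $$(\alpha\beta)^n\lambda_{2n,1}=1,\qquad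 \frac{\beta^2}{\alpha^2}=\frac{\tau(b,b)}{\tau(b,a)^2},$$ and put $S_{j,0}=\lambda_{2j+1,1}\alpha^{j+1}\beta^j$, $S_{j,1}=h(a,a^{2j+1}b)\lambda_{2j+1,1}\alpha^j\beta^{j+1}$. Let $S=\{g\in G: g\triangleleft x=g\}=\{a^{2i},a^{2i}b\}$ and $T=G\setminus S=\{a^{2i+1},a^{2i+1}b\}$, $0\le i\le n-1$. Define matrices $w^1,w^2,w^3,w^4$, indexed by $S\times S$, $S\times T$, $T\times S$, $T\times T$ respectively, by (for $0\le i,j\le n-1$) - $w^1(a^{2i},a^{2j})=w^1(a^{2i}b,a^{2j})=w^1(a^{2i},a^{2j}b)=-w^1(a^{2i}b,a^{2j}b)=\lambda_{2j,1}^{2i}(\alpha\beta)^{2ij}\sigma(a^{2j})^i$; - $w^2(a^{2i},a^{2j+1})=w^2(a^{2i},a^{2j+1}b)=\lambda_{2i,2j+1}(S_{j,0}S_{j,1})^i$ and $w^2(a^{2i}b,a^{2j+1})=-w^2(a^{2i}b,a^{2j+1}b)=\frac{\tau(b,a)\beta}{\tau(b,a^{2i})\alpha}\lambda_{2i,2j+1}(S_{j,0}S_{j,1})^i$;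 - $w^3(a^{2i+1},a^{2j})=w^3(a^{2i+1}b,a^{2j})=\lambda_{2j,2i+1}(S_{i,0}S_{i,1})^j$ and $w^3(a^{2i+1},a^{2j}b)=-w^3(a^{2i+1}b,a^{2j}b)=-\frac{\tau(b,a)\beta}{\tau(b,a^{2j})\alpha}\lambda_{2j,2i+1}(S_{i,0}S_{i,1})^j$; - $w^4(a^{2i+1},a^{2j+1})=\lambda_{2i+1,2j+1}S_{j,0}^{i+1}S_{j,1}^i$, $\ w^4(a^{2i+1},a^{2j+1}b)=\lambda_{2i+1,2j+1}S_{j,0}^{i}S_{j,1}^{i+1}$, $\ w^4(a^{2i+1}b,a^{2j+1})=h(a^{2i+1}b,a^{2j+1})\lambda_{2i+1,2j+1}S_{j,0}^{i}S_{j,1}^{i+1}$, $\ w^4(a^{2i+1}b,a^{2j+1}b)=h(a^{2i+1}b,a^{2j+1}b)\lambda_{2i+1,2j+1}S_{j,0}^{i+1}S_{j,1}^{i}$, and let $$R_{\alpha,\beta}=\sum_{s,s'\in S}w^1(s,s')e_s\otimes e_{s'}+\sum_{s\in S,t\in T}w^2(s,t)e_sx\otimes e_t+\sum_{t\in T,s\in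 S}w^3(t,s)e_t\otimes e_sx+\sum_{t,t'\in T}w^4(t,t')e_tx\otimes e_{t'}x.$$ Then $R_{\alpha,\beta}$ is a minimal quasitriangular structure on $K(8n,\sigma,\tau)$ if and only if the four matrices $w^1,w^2,w^3,w^4$ are all non-degenerate. Moreover, $w^1,w^2,w^3,w^4$ are all non-degenerate if and only if $(\sigma(a)\alpha\beta)^2\,\sigma(a^2)\,\tau(a,a)^{-2}$ is a primitive $n$-th root of $1$. -/

import Mathlib

open scoped TensorProduct BigOperators

/-! ### Quasitriangular Hopf algebras -/

section Quasitriangular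

variable {k H : Type*} [CommRing k] [Ring H] [HopfAlgebra k H]

/-- `R₁₂ = R ⊗ 1`, as an element of `H ⊗ (H ⊗ H)`. -/
noncomputable def legs12 (R : H ⊗[k] H) : H ⊗[k] (H ⊗[k] H) :=
  Algebra.TensorProduct.map (AlgHom.id k H)
    (Algebra.TensorProduct.includeLeft : H →ₐ[k] H ⊗[k] H) R

/-- `R₁₃ = ∑ R⁽¹⁾ ⊗ 1 ⊗ R⁽²⁾`, as an element of `H ⊗ (H ⊗ H)`. -/
noncomputable def legs13 (R : H ⊗[k] H) : H ⊗[k] (H ⊗[k] H) :=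
  Algebra.TensorProduct.map (AlgHom.id k H)
    (Algebra.TensorProduct.includeRight : H →ₐ[k] H ⊗[k] H) R

/-- `R₂₃ = 1 ⊗ R`, as an element of `H ⊗ (H ⊗ H)`. -/
noncomputable def legs23 (R : H ⊗[k] H) : H ⊗[k] (H ⊗[k] H) := 1 ⊗ₜ[k] R

/-- `R` is a universal R-matrix of the Hopf algebra `H`, that is, `(H, R)` is a quasitriangular
Hopf algebra. -/
structure IsUniversalRMatrix (R : H ⊗[k] H) : Prop where
  isUnit : IsUnit R
  comul_left : TensorProduct.assoc k H H H
    (LinearMap.rTensor H (Coalgebra.comul : H →ₗ[k] H ⊗[k] H) R) = legs13 R * legs23 R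
  comul_right : LinearMap.lTensor H (Coalgebra.comul : H →ₗ[k] H ⊗[k] H) R = legs13 R * legs12 R
  comul_op : ∀ h : H, TensorProduct.comm k H H (Coalgebra.comul h) * R = R * Coalgebra.comul h

/-- The map `l : H* → H`, `l(f) = (f ⊗ id)(R)`. -/
noncomputable def leftContraction (R : H ⊗[k] H) : Module.Dual k H →ₗ[k] H :=
  (TensorProduct.lid k H).toLinearMap ∘ₗ LinearMap.applyₗ R ∘ₗ LinearMap.rTensorHom H

/-- The map `r : H* → H`, `r(f) = (id ⊗ f)(R)`. -/
noncomputable def rightContraction (R : H ⊗[k] H) : Module.Dual k H →ₗ[k] H :=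
  (TensorProduct.rid k H).toLinearMap ∘ₗ LinearMap.applyₗ R ∘ₗ LinearMap.lTensorHom H

/-- `R` is a minimal quasitriangular structure on `H`: it is a universal R-matrix and
`H = H_l H_r`, where `H_l` and `H_r` are the images of `l` and `r`
(the product of subspaces is the span of the products of their elements). -/
def IsMinimalQuasitriangular (R : H ⊗[k] H) : Prop :=
  IsUniversalRMatrix R ∧
    LinearMap.range (leftContraction R) * LinearMap.range (rightContraction R) = ⊤

end Quasitriangular

/-! ### The Hopf algebras `k^G #_{σ,τ} kℤ₂` -/

/-- The data `(◁, σ, τ)` defining `k^G #_{σ,τ} kℤ₂`. An injective homomorphism from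
`ℤ₂ = {1, x}` to `Aut G` is the same as the automorphism `act : g ↦ g ◁ x`, of order two. -/
structure ExtensionData (k G : Type*) [Field k] [CommGroup G] where
  act : G ≃* G
  act_act : ∀ g, act (act g) = g
  act_ne_refl : act ≠ MulEquiv.refl G
  σ : G → kˣ
  σ_act : ∀ g, σ (act g) = σ g
  σ_one : σ 1 = 1
  τ : G → G → kˣ
  τ_one_left : ∀ g, τ 1 g = 1
  τ_one_right : ∀ g, τ g 1 = 1
  τ_cocycle : ∀ g h l, τ g h * τ (g * h) l = τ h l * τ g (h * l)
  σ_mul : ∀ g h, σ (g * h) * (σ g)⁻¹ * (σ h)⁻¹ = τ g h * τ (act g) (act h)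

namespace ExtensionData

section Algebra

variable {k G : Type*} [Field k] [CommGroup G] (D : ExtensionData k G)

/-- The vector space `k^G #_{σ,τ} kℤ₂`; the pair `(p, q)` is `∑ p(g) e_g + ∑ q(g) e_g x`. -/
def Alg (_D : ExtensionData k G) : Type _ := (G → k) × (G → k)

instance : AddCommGroup D.Alg := inferInstanceAs (AddCommGroup ((G → k) × (G → k)))

instance : Module k D.Alg := inferInstanceAs (Module k ((G → k) × (G → k)))

instance : Mul D.Alg :=
  ⟨fun u v => (fun g => u.1 g * v.1 g + u.2 g * v.2 (D.act g) * D.σ g,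
    fun g => u.1 g * v.2 g + u.2 g * v.1 (D.act g))⟩

instance : One D.Alg := ⟨(1, 0)⟩

variable {D}

theorem Alg.ext {u v : D.Alg} (h₁ : ∀ g, u.1 g = v.1 g) (h₂ : ∀ g, u.2 g = v.2 g) : u = v :=
  Prod.ext (funext h₁) (funext h₂)

theorem mul_fst (u v : D.Alg) (g : G) :
    (u * v).1 g = u.1 g * v.1 g + u.2 g * v.2 (D.act g) * D.σ g := rfl

theorem mul_snd (u v : D.Alg) (g : G) :
    (u * v).2 g = u.1 g * v.2 g + u.2 g * v.1 (D.act g) := rfl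

theorem one_fst (g : G) : (1 : D.Alg).1 g = 1 := rfl

theorem one_snd (g : G) : (1 : D.Alg).2 g = 0 := rfl

theorem zero_fst (g : G) : (0 : D.Alg).1 g = 0 := rfl

theorem zero_snd (g : G) : (0 : D.Alg).2 g = 0 := rfl

theorem add_fst (u v : D.Alg) (g : G) : (u + v).1 g = u.1 g + v.1 g := rfl

theorem add_snd (u v : D.Alg) (g : G) : (u + v).2 g = u.2 g + v.2 g := rfl

theorem smul_fst (c : k) (u : D.Alg) (g : G) : (c • u).1 g = c * u.1 g := rfl

theorem smul_snd (c : k) (u : D.Alg) (g : G) : (c • u).2 g = c * u.2 g := rfl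

variable (D)

instance : Ring D.Alg :=
  { (inferInstance : AddCommGroup D.Alg) with
    mul_assoc := fun u v w => by
      apply Alg.ext <;> intro g <;> simp only [mul_fst, mul_snd, D.act_act, D.σ_act] <;> ring
    one_mul := fun u => by
      apply Alg.ext <;> intro g <;> simp only [mul_fst, mul_snd, one_fst, one_snd] <;> ring
    mul_one := fun u => by
      apply Alg.ext <;> intro g <;> simp only [mul_fst, mul_snd, one_fst, one_snd] <;> ring
    left_distrib := fun u v w => by
      apply Alg.ext <;> intro g <;> simp only [mul_fst, mul_snd, add_fst, add_snd] <;> ring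
    right_distrib := fun u v w => by
      apply Alg.ext <;> intro g <;> simp only [mul_fst, mul_snd, add_fst, add_snd] <;> ring
    zero_mul := fun u => by
      apply Alg.ext <;> intro g <;> simp only [mul_fst, mul_snd, zero_fst, zero_snd] <;> ring
    mul_zero := fun u => by
      apply Alg.ext <;> intro g <;> simp only [mul_fst, mul_snd, zero_fst, zero_snd] <;> ring }

instance : Algebra k D.Alg :=
  Algebra.ofModule
    (fun c u v => by
      apply Alg.ext <;> intro g <;> simp only [mul_fst, mul_snd, smul_fst, smul_snd] <;> ring)
    (fun c u v => by
      apply Alg.ext <;> intro g <;> simp only [mul_fst, mul_snd, smul_fst, smul_snd] <;> ring)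

/-- The generator `x = ∑ e_g x`. -/
def x : D.Alg := (0, 1)

/-- The coordinate of `e_g`. -/
def coordE (g : G) : D.Alg →ₗ[k] k where
  toFun u := u.1 g
  map_add' _ _ := rfl
  map_smul' _ _ := rfl

/-- The coordinate of `e_g x`. -/
def coordX (g : G) : D.Alg →ₗ[k] k where
  toFun u := u.2 g
  map_add' _ _ := rfl
  map_smul' _ _ := rfl

/-- The counit: `ε(e_g) = δ_{g,1}`, `ε(x) = 1`, so `ε(e_g x) = δ_{g,1}`. -/
def counitMap : D.Alg →ₗ[k] k := D.coordE 1 + D.coordX 1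

variable {D}

theorem coordE_apply (g : G) (u : D.Alg) : D.coordE g u = u.1 g := rfl

theorem coordX_apply (g : G) (u : D.Alg) : D.coordX g u = u.2 g := rfl

theorem counitMap_mul (u v : D.Alg) : D.counitMap (u * v) = D.counitMap u * D.counitMap v := by
  have h1 : D.act 1 = 1 := map_one _
  simp only [counitMap, LinearMap.add_apply, coordE_apply, coordX_apply, mul_fst, mul_snd, h1,
    D.σ_one, Units.val_one]
  ring

theorem counitMap_one : D.counitMap 1 = 1 := by
  simp [counitMap, coordE_apply, coordX_apply, one_fst, one_snd]

theorem τ_inv (g : G) : D.τ g g⁻¹ = D.τ g⁻¹ g := by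
  simpa [D.τ_one_left, D.τ_one_right] using D.τ_cocycle g g⁻¹ g

theorem x_fst (h : G) : D.x.1 h = 0 := rfl

theorem x_snd (h : G) : D.x.2 h = 1 := rfl

theorem act_eq_iff (g h : G) : D.act g = h ↔ g = D.act h :=
  ⟨fun H => by rw [← H, D.act_act], fun H => by rw [H, D.act_act]⟩

variable (D) [DecidableEq G]

/-- The basis element `e_g`. -/
def e (g : G) : D.Alg := (Pi.single g 1, 0)

/-- The basis element `e_g x`. -/
def eX (g : G) : D.Alg := (0, Pi.single g 1)

variable {D}

theorem e_fst (g h : G) : (D.e g).1 h = if h = g then 1 else 0 := Pi.single_apply ..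

theorem e_snd (g h : G) : (D.e g).2 h = 0 := rfl

theorem eX_fst (g h : G) : (D.eX g).1 h = 0 := rfl

theorem eX_snd (g h : G) : (D.eX g).2 h = if h = g then 1 else 0 := Pi.single_apply ..

theorem coordE_e (g h : G) : D.coordE h (D.e g) = if h = g then 1 else 0 :=
  e_fst (D := D) g h

theorem coordX_e (g h : G) : D.coordX h (D.e g) = 0 := rfl

theorem coordE_eX (g h : G) : D.coordE h (D.eX g) = 0 := rfl

theorem coordX_eX (g h : G) : D.coordX h (D.eX g) = if h = g then 1 else 0 :=
  eX_snd (D := D) g h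

theorem e_mul_x (g : G) : D.e g * D.x = D.eX g := by
  apply Alg.ext <;> intro l <;>
    simp [mul_fst, mul_snd, e_fst, e_snd, eX_fst, eX_snd, x_fst, x_snd]

theorem x_mul_e (g : G) : D.x * D.e g = D.e (D.act g) * D.x := by
  apply Alg.ext <;> intro l <;>
    simp [mul_fst, mul_snd, e_fst, e_snd, x_fst, x_snd, act_eq_iff]

theorem e_mul_e (g h : G) : D.e g * D.e h = if h = g then D.e g else 0 := by
  apply Alg.ext <;> intro l <;> split_ifs <;>
    simp [mul_fst, mul_snd, e_fst, e_snd, zero_fst, zero_snd] <;> grind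

theorem e_mul_eX (g h : G) : D.e g * D.eX h = if h = g then D.eX g else 0 := by
  rw [← e_mul_x, ← mul_assoc, e_mul_e, ite_mul, zero_mul, e_mul_x]

theorem eX_mul_e (g h : G) : D.eX g * D.e h = if h = D.act g then D.eX g else 0 := by
  rw [← e_mul_x, mul_assoc, x_mul_e, ← mul_assoc, e_mul_e, ite_mul, zero_mul]
  simp only [act_eq_iff]

theorem eX_mul_eX (g h : G) :
    D.eX g * D.eX h = if h = D.act g then (D.σ g : k) • D.e g else 0 := by
  apply Alg.ext <;> intro l <;> split_ifs <;>
    simp [mul_fst, mul_snd, eX_fst, eX_snd, e_fst, e_snd, zero_fst, zero_snd, smul_fst,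
      smul_snd] <;> grind [act_eq_iff]

theorem hom_ext {M : Type*} [AddCommGroup M] [Module k M] [Finite G] {f f' : D.Alg →ₗ[k] M}
    (h₁ : ∀ g, f (D.e g) = f' (D.e g)) (h₂ : ∀ g, f (D.eX g) = f' (D.eX g)) : f = f' := by
  refine LinearMap.prod_ext (R := k) (M := G → k) (M₂ := G → k) ?_ ?_
  · refine LinearMap.pi_ext' fun g => LinearMap.ext_ring ?_
    exact h₁ g
  · refine LinearMap.pi_ext' fun g => LinearMap.ext_ring ?_
    exact h₂ g

theorem counitMap_e (g : G) : D.counitMap (D.e g) = if g = 1 then 1 else 0 := by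
  simp [counitMap, coordE_e, coordX_e, eq_comm]

theorem counitMap_eX (g : G) : D.counitMap (D.eX g) = if g = 1 then 1 else 0 := by
  simp [counitMap, coordE_eX, coordX_eX, eq_comm]

variable [Fintype G]

theorem sum_smul_e (c : G → k) : ∑ g, c g • D.e g = ((c, 0) : D.Alg) := by
  refine Eq.trans (b := ∑ g, ((Pi.single g (c g), 0) : (G → k) × (G → k))) ?_ ?_
  · refine Finset.sum_congr rfl fun g _ => Alg.ext (fun l => ?_) fun l => ?_
    · rw [smul_fst, e_fst]; simp [Pi.single_apply]
    · rw [smul_snd, e_snd]; simp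
  · refine Prod.ext ?_ ?_
    · rw [Prod.fst_sum]; exact Finset.univ_sum_single c
    · rw [Prod.snd_sum]; simp

theorem sum_e : ∑ g, D.e g = (1 : D.Alg) :=
  (Finset.sum_congr rfl fun g _ => (one_smul k (D.e g)).symm).trans (sum_smul_e (D := D) 1)

theorem x_mul_x : D.x * D.x = ∑ g, (D.σ g : k) • D.e g := by
  rw [sum_smul_e]
  apply Alg.ext <;> intro l <;> simp [mul_fst, mul_snd, x_fst, x_snd]

theorem sum_eX : ∑ g, D.eX g = D.x := by
  simp_rw [← e_mul_x]
  rw [← Finset.sum_mul, sum_e, one_mul]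

variable (D)

/-- The comultiplication: `Δ(e_g) = ∑_{h l = g} e_h ⊗ e_l` and
`Δ(e_g x) = Δ(e_g) Δ(x) = ∑_{h l = g} τ(h, l) e_h x ⊗ e_l x`. -/
noncomputable def comulMap : D.Alg →ₗ[k] D.Alg ⊗[k] D.Alg :=
  ∑ h, ∑ l, (D.coordE (h * l)).smulRight (D.e h ⊗ₜ[k] D.e l) +
    ∑ h, ∑ l, (D.coordX (h * l)).smulRight ((D.τ h l : k) • (D.eX h ⊗ₜ[k] D.eX l))

/-- The antipode: `S(e_g) = e_{g⁻¹}`, `S(x) = ∑ σ(g)⁻¹ τ(g, g⁻¹)⁻¹ e_{g ◁ x} x`, and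
`S(e_g x) = S(x) S(e_g) = σ(g⁻¹)⁻¹ τ(g⁻¹, g)⁻¹ e_{g⁻¹ ◁ x} x`. -/
noncomputable def antipodeMap : D.Alg →ₗ[k] D.Alg :=
  ∑ g, (D.coordE g).smulRight (D.e g⁻¹) +
    ∑ g, (D.coordX g).smulRight
      ((((D.σ g⁻¹)⁻¹ * (D.τ g⁻¹ g)⁻¹ : kˣ) : k) • D.eX (D.act g⁻¹))

variable {D}

theorem comulMap_e (g : G) : D.comulMap (D.e g) = ∑ h, D.e h ⊗ₜ[k] D.e (h⁻¹ * g) := by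
  have key : ∀ h l : G, h * l = g ↔ l = h⁻¹ * g := fun h l => by
    rw [eq_inv_mul_iff_mul_eq]
  simp [comulMap, coordE_e, coordX_e, key]

theorem comulMap_eX (g : G) : D.comulMap (D.eX g) =
    ∑ h, (D.τ h (h⁻¹ * g) : k) • (D.eX h ⊗ₜ[k] D.eX (h⁻¹ * g)) := by
  have key : ∀ h l : G, h * l = g ↔ l = h⁻¹ * g := fun h l => by
    rw [eq_inv_mul_iff_mul_eq]
  simp [comulMap, coordE_eX, coordX_eX, key]

theorem antipodeMap_e (g : G) : D.antipodeMap (D.e g) = D.e g⁻¹ := by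
  simp [antipodeMap, coordE_e, coordX_e]

theorem antipodeMap_eX (g : G) : D.antipodeMap (D.eX g) =
    (((D.σ g⁻¹)⁻¹ * (D.τ g⁻¹ g)⁻¹ : kˣ) : k) • D.eX (D.act g⁻¹) := by
  simp [antipodeMap, coordE_eX, coordX_eX]

theorem comul_coassoc : TensorProduct.assoc k D.Alg D.Alg D.Alg ∘ₗ
    D.comulMap.rTensor D.Alg ∘ₗ D.comulMap = D.comulMap.lTensor D.Alg ∘ₗ D.comulMap := by
  apply hom_ext <;> intro g
  · simp only [LinearMap.comp_apply, LinearEquiv.coe_coe, comulMap_e, map_sum,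
      LinearMap.rTensor_tmul, LinearMap.lTensor_tmul, TensorProduct.sum_tmul,
      TensorProduct.tmul_sum, TensorProduct.assoc_tmul]
    rw [Finset.sum_comm]
    refine Finset.sum_congr rfl fun h _ => ?_
    refine Fintype.sum_equiv (Equiv.mulLeft h⁻¹) _ _ fun l => ?_
    simp [mul_assoc]
  · simp only [LinearMap.comp_apply, LinearEquiv.coe_coe, comulMap_eX, map_sum, map_smul,
      LinearMap.rTensor_tmul, LinearMap.lTensor_tmul, TensorProduct.sum_tmul,
      TensorProduct.tmul_sum, TensorProduct.smul_tmul',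
      TensorProduct.assoc_tmul, Finset.smul_sum]
    rw [Finset.sum_comm]
    refine Finset.sum_congr rfl fun h _ => ?_
    refine Fintype.sum_equiv (Equiv.mulLeft h⁻¹) _ _ fun l => ?_
    have h1 : (h⁻¹ * l)⁻¹ * (h⁻¹ * g) = l⁻¹ * g := by group
    have h2 := D.τ_cocycle h (h⁻¹ * l) (l⁻¹ * g)
    have h3 : h⁻¹ * l * (l⁻¹ * g) = h⁻¹ * g := by group
    rw [mul_inv_cancel_left, h3] at h2
    rw [Equiv.coe_mulLeft, h1]
    simp only [← TensorProduct.smul_tmul', TensorProduct.tmul_smul, smul_smul, ← Units.val_mul]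
    rw [mul_comm, h2, mul_comm]

theorem comulMap_one : D.comulMap 1 = 1 := by
  rw [← sum_e, map_sum, Algebra.TensorProduct.one_def, ← sum_e]
  simp only [comulMap_e]
  rw [Finset.sum_comm, TensorProduct.sum_tmul]
  refine Finset.sum_congr rfl fun h _ => ?_
  rw [TensorProduct.tmul_sum]
  exact Fintype.sum_equiv (Equiv.mulLeft h⁻¹) _ _ fun l => rfl

theorem comulMap_mul (u v : D.Alg) : D.comulMap (u * v) = D.comulMap u * D.comulMap v := by
  have : (LinearMap.mul k D.Alg).compr₂ D.comulMap =
      (LinearMap.mul k (D.Alg ⊗[k] D.Alg)).compl₁₂ D.comulMap D.comulMap := by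
    apply hom_ext <;> intro g <;> apply hom_ext <;> intro h
    all_goals
      simp only [LinearMap.compr₂_apply, LinearMap.compl₁₂_apply, LinearMap.mul_apply',
        comulMap_e, comulMap_eX, Finset.sum_mul_sum, smul_mul_assoc, mul_smul_comm,
        Algebra.TensorProduct.tmul_mul_tmul]
    · rw [e_mul_e, apply_ite D.comulMap, map_zero, comulMap_e, Finset.ite_sum_zero]
      refine Finset.sum_congr rfl fun a _ => ?_
      rw [Fintype.sum_eq_single a fun b hb => by rw [e_mul_e, if_neg hb, TensorProduct.zero_tmul],
        e_mul_e, e_mul_e, if_pos rfl]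
      simp only [mul_right_inj, TensorProduct.tmul_ite]
    · rw [e_mul_eX, apply_ite D.comulMap, map_zero, comulMap_eX, Finset.ite_sum_zero]
      refine Finset.sum_congr rfl fun a _ => ?_
      rw [Fintype.sum_eq_single a fun b hb => by
          rw [e_mul_eX, if_neg hb, TensorProduct.zero_tmul, smul_zero],
        e_mul_eX, e_mul_eX, if_pos rfl]
      simp only [mul_right_inj, TensorProduct.tmul_ite, smul_ite,
        smul_zero]
      split_ifs with H
      · rw [H]
      · rfl
    · rw [eX_mul_e, apply_ite D.comulMap, map_zero, comulMap_eX, Finset.ite_sum_zero]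
      refine Finset.sum_congr rfl fun a _ => ?_
      rw [Fintype.sum_eq_single (D.act a) fun b hb => by
          rw [eX_mul_e, if_neg hb, TensorProduct.zero_tmul, smul_zero],
        eX_mul_e, eX_mul_e, if_pos rfl]
      simp only [map_mul, map_inv, mul_right_inj, TensorProduct.tmul_ite, smul_ite, smul_zero]
    · rw [eX_mul_eX, apply_ite D.comulMap, map_zero, map_smul, comulMap_e,
        Finset.smul_sum, Finset.ite_sum_zero]
      refine Finset.sum_congr rfl fun a _ => ?_
      rw [Fintype.sum_eq_single (D.act a) fun b hb => by
          rw [eX_mul_eX, if_neg hb, TensorProduct.zero_tmul, smul_zero, smul_zero],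
        eX_mul_eX, eX_mul_eX, if_pos rfl]
      simp only [map_mul, map_inv, mul_right_inj, TensorProduct.tmul_ite, smul_ite, smul_zero]
      split_ifs with H
      · subst H
        have h1 := D.σ_mul a (a⁻¹ * g)
        rw [mul_inv_cancel_left] at h1
        rw [TensorProduct.tmul_smul, ← TensorProduct.smul_tmul', smul_smul, smul_smul, smul_smul]
        congr 1
        have h2 : D.σ g = D.τ a (a⁻¹ * g) * D.τ (D.act a) (D.act (a⁻¹ * g)) *
            D.σ (a⁻¹ * g) * D.σ a := by
          rw [← h1]; group
        rw [h2, map_mul, map_inv]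
        push_cast
        ring
      · rfl
  exact LinearMap.congr_fun₂ this u v

theorem rTensor_counit_comp : D.counitMap.rTensor D.Alg ∘ₗ D.comulMap =
    TensorProduct.mk k k D.Alg 1 := by
  apply hom_ext <;> intro g
  · simp only [LinearMap.comp_apply, comulMap_e, map_sum, LinearMap.rTensor_tmul, counitMap_e,
      TensorProduct.mk_apply]
    rw [Fintype.sum_eq_single 1 fun b hb => by rw [if_neg hb, TensorProduct.zero_tmul]]
    simp
  · simp only [LinearMap.comp_apply, comulMap_eX, map_sum, map_smul, LinearMap.rTensor_tmul,
      counitMap_eX, TensorProduct.mk_apply]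
    rw [Fintype.sum_eq_single 1 fun b hb => by rw [if_neg hb, TensorProduct.zero_tmul, smul_zero]]
    simp [D.τ_one_left]

theorem lTensor_counit_comp : D.counitMap.lTensor D.Alg ∘ₗ D.comulMap =
    (TensorProduct.mk k D.Alg k).flip 1 := by
  have key : ∀ b g : G, b ≠ g → b⁻¹ * g ≠ 1 := fun b g h h' => h (inv_mul_eq_one.1 h')
  apply hom_ext <;> intro g
  · simp only [LinearMap.comp_apply, comulMap_e, map_sum, LinearMap.lTensor_tmul, counitMap_e,
      LinearMap.flip_apply, TensorProduct.mk_apply]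
    rw [Fintype.sum_eq_single g fun b hb => by
      rw [if_neg (key b g hb), TensorProduct.tmul_zero]]
    simp
  · simp only [LinearMap.comp_apply, comulMap_eX, map_sum, map_smul, LinearMap.lTensor_tmul,
      counitMap_eX, LinearMap.flip_apply, TensorProduct.mk_apply]
    rw [Fintype.sum_eq_single g fun b hb => by
      rw [if_neg (key b g hb), TensorProduct.tmul_zero, smul_zero]]
    simp [D.τ_one_right]

theorem mul_antipode_rTensor : LinearMap.mul' k D.Alg ∘ₗ D.antipodeMap.rTensor D.Alg ∘ₗ
    D.comulMap = Algebra.linearMap k D.Alg ∘ₗ D.counitMap := by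
  apply hom_ext <;> intro g
  · simp only [LinearMap.comp_apply, comulMap_e, map_sum, LinearMap.rTensor_tmul, counitMap_e,
      antipodeMap_e, LinearMap.mul'_apply, Algebra.linearMap_apply, e_mul_e]
    simp only [mul_eq_left]
    split_ifs with H
    · rw [map_one, ← sum_e]
      exact Fintype.sum_equiv (Equiv.inv G) _ _ fun l => rfl
    · simp
  · simp only [LinearMap.comp_apply, comulMap_eX, map_sum, map_smul, LinearMap.rTensor_tmul,
      counitMap_eX, antipodeMap_eX, LinearMap.mul'_apply, Algebra.linearMap_apply,
      smul_mul_assoc, eX_mul_eX, D.act_act, mul_eq_left]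
    split_ifs with H
    · subst H
      rw [map_one, ← sum_e]
      refine Fintype.sum_equiv ((Equiv.inv G).trans D.act.toEquiv) _ _ fun l => ?_
      rw [mul_one, smul_smul, smul_smul, D.σ_act, τ_inv, ← Units.val_mul, ← Units.val_mul]
      rw [show D.τ l⁻¹ l * ((D.σ l⁻¹)⁻¹ * (D.τ l⁻¹ l)⁻¹) * D.σ l⁻¹ = 1 by
        rw [mul_comm, mul_comm (D.τ l⁻¹ l), inv_mul_cancel_right, mul_inv_cancel],
        Units.val_one, one_smul]
      rfl
    · simp

theorem mul_antipode_lTensor : LinearMap.mul' k D.Alg ∘ₗ D.antipodeMap.lTensor D.Alg ∘ₗ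
    D.comulMap = Algebra.linearMap k D.Alg ∘ₗ D.counitMap := by
  have key : ∀ l g : G, (l⁻¹ * g)⁻¹ = l ↔ g = 1 := fun l g => by simp
  apply hom_ext <;> intro g
  · simp only [LinearMap.comp_apply, comulMap_e, map_sum, LinearMap.lTensor_tmul, counitMap_e,
      antipodeMap_e, LinearMap.mul'_apply, Algebra.linearMap_apply, e_mul_e, key]
    split_ifs with H
    · rw [map_one, ← sum_e]
    · simp
  · simp only [LinearMap.comp_apply, comulMap_eX, map_sum, map_smul, LinearMap.lTensor_tmul,
      counitMap_eX, antipodeMap_eX, LinearMap.mul'_apply, Algebra.linearMap_apply,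
      mul_smul_comm, eX_mul_eX, D.act.injective.eq_iff, key]
    split_ifs with H
    · subst H
      rw [map_one, ← sum_e]
      refine Finset.sum_congr rfl fun l _ => ?_
      rw [mul_one, inv_inv, smul_smul, smul_smul, ← Units.val_mul, ← Units.val_mul]
      rw [show D.τ l l⁻¹ * ((D.σ l)⁻¹ * (D.τ l l⁻¹)⁻¹) * D.σ l = 1 by
        rw [mul_comm, mul_comm (D.τ l l⁻¹), inv_mul_cancel_right, mul_inv_cancel],
        Units.val_one, one_smul]
    · simp

variable (D)

noncomputable instance : Coalgebra k D.Alg where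
  comul := D.comulMap
  counit := D.counitMap
  coassoc := comul_coassoc
  rTensor_counit_comp_comul := rTensor_counit_comp
  lTensor_counit_comp_comul := lTensor_counit_comp

noncomputable instance : Bialgebra k D.Alg :=
  Bialgebra.mk' k D.Alg counitMap_one (counitMap_mul _ _) comulMap_one (comulMap_mul _ _)

noncomputable instance : HopfAlgebra k D.Alg where
  antipode := D.antipodeMap
  mul_antipode_rTensor_comul := mul_antipode_rTensor
  mul_antipode_lTensor_comul := mul_antipode_lTensor

variable {D}

theorem comul_e (g : G) :
    Coalgebra.comul (R := k) (D.e g) = ∑ h, D.e h ⊗ₜ[k] D.e (h⁻¹ * g) := comulMap_e g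

theorem comul_x : Coalgebra.comul (R := k) D.x =
    (∑ g, ∑ h, (D.τ g h : k) • (D.e g ⊗ₜ[k] D.e h)) * (D.x ⊗ₜ[k] D.x) := by
  have h : Coalgebra.comul (R := k) D.x = D.comulMap D.x := rfl
  rw [h, ← sum_eX, map_sum, sum_eX, Finset.sum_mul]
  simp only [comulMap_eX, Finset.sum_mul, smul_mul_assoc, Algebra.TensorProduct.tmul_mul_tmul,
    e_mul_x]
  rw [Finset.sum_comm]
  refine Finset.sum_congr rfl fun g _ => ?_
  exact Fintype.sum_equiv (Equiv.mulLeft g⁻¹) _ _ fun l => rfl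

theorem counit_e (g : G) : Coalgebra.counit (R := k) (D.e g) = if g = 1 then 1 else 0 :=
  counitMap_e g

theorem counit_x : Coalgebra.counit (R := k) D.x = 1 := by
  show D.counitMap D.x = 1
  simp [counitMap, coordE_apply, coordX_apply, x_fst, x_snd]

theorem antipode_e (g : G) : HopfAlgebra.antipode k (D.e g) = D.e g⁻¹ := antipodeMap_e g

theorem antipode_x : HopfAlgebra.antipode k D.x =
    ∑ g, (((D.σ g)⁻¹ * (D.τ g g⁻¹)⁻¹ : kˣ) : k) • (D.e (D.act g) * D.x) := by
  show D.antipodeMap D.x = _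
  simp only [← sum_eX, map_sum, antipodeMap_eX]
  simp only [sum_eX, e_mul_x]
  exact Fintype.sum_equiv (Equiv.inv G) _ _ fun l => by simp

end Algebra

/-! ### Elements of non-trivial form -/

section NontrivialForm

variable {k G : Type*} [Field k] [CommGroup G] [Fintype G] [DecidableEq G]
  (D : ExtensionData k G)

/-- `S = {g | g ◁ x = g}`. -/
abbrev S : Type _ := {g : G // D.act g = g}

/-- `T = {g | g ◁ x ≠ g}`. -/
abbrev T : Type _ := {g : G // D.act g ≠ g}

/-- The element
`∑ w¹(s₁, s₂) e_{s₁} ⊗ e_{s₂} + ∑ w²(s, t) e_s x ⊗ e_t + ∑ w³(t, s) e_t ⊗ e_s x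
  + ∑ w⁴(t₁, t₂) e_{t₁} x ⊗ e_{t₂} x` of `H ⊗ H`. -/
noncomputable def nontrivialForm (w₁ : Matrix D.S D.S k) (w₂ : Matrix D.S D.T k)
    (w₃ : Matrix D.T D.S k) (w₄ : Matrix D.T D.T k) : D.Alg ⊗[k] D.Alg :=
  ∑ s₁ : D.S, ∑ s₂ : D.S, w₁ s₁ s₂ • (D.e s₁ ⊗ₜ[k] D.e s₂) +
  ∑ s : D.S, ∑ t : D.T, w₂ s t • ((D.e s * D.x) ⊗ₜ[k] D.e t) +
  ∑ t : D.T, ∑ s : D.S, w₃ t s • (D.e t ⊗ₜ[k] (D.e s * D.x)) +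
  ∑ t₁ : D.T, ∑ t₂ : D.T, w₄ t₁ t₂ • ((D.e t₁ * D.x) ⊗ₜ[k] (D.e t₂ * D.x))

/-- `η(g, h) = τ(g, h) τ(h, g)⁻¹`. -/
def η (g h : G) : kˣ := D.τ g h * (D.τ h g)⁻¹

/-- `h(t₁, t₂) = τ(t₁, t₂) / τ(t₂ ◁ x, t₁ ◁ x)`. -/
def hh (t₁ t₂ : G) : kˣ := D.τ t₁ t₂ / D.τ (D.act t₂) (D.act t₁)

end NontrivialForm

end ExtensionData

/-! ### The Hopf algebras `K(8n, σ, τ)` -/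

/-- `ℤ_{2n} × ℤ_2 = ⟨a, b | a^{2n} = b² = 1, ab = ba⟩`, written multiplicatively. -/
abbrev KGroup (n : ℕ) : Type := Multiplicative (ZMod (2 * n)) × Multiplicative (ZMod 2)

namespace KGroup

/-- The generator `a`, of order `2n`. -/
def a (n : ℕ) : KGroup n := (Multiplicative.ofAdd 1, 1)

/-- The generator `b`, of order `2`. -/
def b (n : ℕ) : KGroup n := (1, Multiplicative.ofAdd 1)

variable {n : ℕ}

/-- The number `0 ≤ i < n` such that `g` is one of `a^{2i}`, `a^{2i}b`, `a^{2i+1}`, `a^{2i+1}b`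
(for `n ≥ 1`). -/
def half (g : KGroup n) : ℕ := (Multiplicative.toAdd g.1).val / 2

/-- `g = a^i` for some `i`, as opposed to `g = a^i b`. -/
def IsPowA (g : KGroup n) : Prop := g.2 = 1

instance (g : KGroup n) : Decidable g.IsPowA := inferInstanceAs (Decidable (g.2 = 1))

end KGroup

namespace ExtensionData

open KGroup

section K

variable {k : Type*} [Field k] {n : ℕ} (D : ExtensionData k (KGroup n))

/-- The data define a Hopf algebra `K(8n, σ, τ)`: the action is `a ◁ x = ab`, `b ◁ x = b`. -/
def IsK : Prop := D.act (a n) = a n * b n ∧ D.act (b n) = b n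

/-- `P_i = τ(a, a) τ(a, a²) ⋯ τ(a, a^{i-1})`, with `P_0 = P_1 = 1`. -/
def P (i : ℕ) : kˣ := ∏ l ∈ Finset.Ico 1 i, D.τ (a n) (a n ^ l)

/-- `lam (2i) j = P_{2i}⁻¹ σ(a^j)^i` and `lam (2i+1) j = P_{2i+1}⁻¹ σ(a^j)^i`. -/
def lam (m j : ℕ) : kˣ := (D.P m)⁻¹ * D.σ (a n ^ j) ^ (m / 2)

/-- The conditions on the parameters `(α, β)`. -/
def IsAdmissible (α β : k) : Prop :=
  (α * β) ^ n * D.lam (2 * n) 1 = 1 ∧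
    β ^ 2 / α ^ 2 = (D.τ (b n) (b n) : k) / (D.τ (b n) (a n) : k) ^ 2

variable (α β : k)

/-- `S_{j,0} = λ_{2j+1,1} α^{j+1} β^j`. -/
def S₀ (j : ℕ) : k := D.lam (2 * j + 1) 1 * α ^ (j + 1) * β ^ j

/-- `S_{j,1} = h(a, a^{2j+1}b) λ_{2j+1,1} α^j β^{j+1}`. -/
def S₁ (j : ℕ) : k :=
  D.hh (a n) (a n ^ (2 * j + 1) * b n) * D.lam (2 * j + 1) 1 * α ^ j * β ^ (j + 1)

/-- `w¹(a^{2i}, a^{2j}) = w¹(a^{2i}b, a^{2j}) = w¹(a^{2i}, a^{2j}b) = -w¹(a^{2i}b, a^{2j}b)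
  = (λ_{2j,1})^{2i} (αβ)^{2ij} σ(a^{2j})^i`. -/
def w₁ : Matrix D.S D.S k := fun s s' =>
  let i := half s.1
  let j := half s'.1
  let c : k := (D.lam (2 * j) 1 : k) ^ (2 * i) * (α * β) ^ (2 * i * j) *
    (D.σ (a n ^ (2 * j)) : k) ^ i
  if IsPowA s.1 ∨ IsPowA s'.1 then c else -c

/-- `w²(a^{2i}, a^{2j+1}) = w²(a^{2i}, a^{2j+1}b) = λ_{2i,2j+1} (S_{j,0} S_{j,1})^i` and
`w²(a^{2i}b, a^{2j+1}) = -w²(a^{2i}b, a^{2j+1}b)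
  = (τ(b,a) β / (τ(b,a^{2i}) α)) λ_{2i,2j+1} (S_{j,0} S_{j,1})^i`. -/
def w₂ : Matrix D.S D.T k := fun s t =>
  let i := half s.1
  let j := half t.1
  let c : k := D.lam (2 * i) (2 * j + 1) * (D.S₀ α β j * D.S₁ α β j) ^ i
  let d : k := D.τ (b n) (a n) * β / (D.τ (b n) (a n ^ (2 * i)) * α)
  if IsPowA s.1 then c else if IsPowA t.1 then d * c else -(d * c)

/-- `w³(a^{2i+1}, a^{2j}) = w³(a^{2i+1}b, a^{2j}) = λ_{2j,2i+1} (S_{i,0} S_{i,1})^j` and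
`w³(a^{2i+1}, a^{2j}b) = -w³(a^{2i+1}b, a^{2j}b)
  = -(τ(b,a) β / (τ(b,a^{2j}) α)) λ_{2j,2i+1} (S_{i,0} S_{i,1})^j`. -/
def w₃ : Matrix D.T D.S k := fun t s =>
  let i := half t.1
  let j := half s.1
  let c : k := D.lam (2 * j) (2 * i + 1) * (D.S₀ α β i * D.S₁ α β i) ^ j
  let d : k := D.τ (b n) (a n) * β / (D.τ (b n) (a n ^ (2 * j)) * α)
  if IsPowA s.1 then c else if IsPowA t.1 then -(d * c) else d * c

/-- `w⁴(a^{2i+1}, a^{2j+1}) = λ_{2i+1,2j+1} S_{j,0}^{i+1} S_{j,1}^i`,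
`w⁴(a^{2i+1}, a^{2j+1}b) = λ_{2i+1,2j+1} S_{j,0}^i S_{j,1}^{i+1}`,
`w⁴(a^{2i+1}b, a^{2j+1}) = h(a^{2i+1}b, a^{2j+1}) λ_{2i+1,2j+1} S_{j,0}^i S_{j,1}^{i+1}`,
`w⁴(a^{2i+1}b, a^{2j+1}b) = h(a^{2i+1}b, a^{2j+1}b) λ_{2i+1,2j+1} S_{j,0}^{i+1} S_{j,1}^i`. -/
def w₄ : Matrix D.T D.T k := fun t t' =>
  let i := half t.1
  let j := half t'.1
  let c₀ : k := D.lam (2 * i + 1) (2 * j + 1) * D.S₀ α β j ^ (i + 1) * D.S₁ α β j ^ i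
  let c₁ : k := D.lam (2 * i + 1) (2 * j + 1) * D.S₀ α β j ^ i * D.S₁ α β j ^ (i + 1)
  if IsPowA t.1 then
    if IsPowA t'.1 then c₀ else c₁
  else
    if IsPowA t'.1 then D.hh t.1 t'.1 * c₁ else D.hh t.1 t'.1 * c₀

/-- The element `R_{α,β}`. -/
noncomputable def Rαβ [NeZero n] : D.Alg ⊗[k] D.Alg :=
  D.nontrivialForm (D.w₁ α β) (D.w₂ α β) (D.w₃ α β) (D.w₄ α β)

end K

end ExtensionData

/-! Parity. In the group of the theorem, S is a subgroup of index two, so an element g has a parity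
|g| in Z/2, and the four sums in `Rαβ` are one sum ∑ W(g,h) e_g x^{|h|} ⊗ e_h x^{|g|}. Since x moves
e_g to e_{g◁x}, each R-matrix axiom for such an element can be compared coefficient by coefficient.
The axioms follow from W being nonzero, from two multiplicativity identities for W (twisted by τ and
σ) and from one compatibility of W with the action (`isUniversalRMatrix_parityForm`).

Normal form. A cocycle on G is a bicharacter up to coboundary. Rescaling by the function F = `gauge`
turns τ into (a^i b^e, a^j b^f) ↦ (-1)^{ej} (`gauge_mul_gauge`) and determines σ up to a single
scalar c (`σ_eq`). The second condition on α, β says that δ = βτ(a,b)/α is a square root of τ(b,b),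
which is what the rescaling needs; the first says that ζ = σ(a)αβ satisfies ζ^n = P_{2n}. In these
coordinates W(a^i b^e, a^j b^f) is, up to sign and factors of F, equal to q^{⌊i/2⌋⌊j/2⌋} ζ^{…}
α^{…}, with ζ = cα² and q = -ζ²c² (`coeffR_mul`). Here q is the scalar named in the theorem
(`q_eq_main`), and σ(a^{2n}) = 1 forces q^n = 1. The axioms become identities between monomials, so
`Rαβ` is a universal R-matrix for all admissible α, β, and only minimality depends on q.

Minimality. If q is a primitive n-th root of 1, each of the four matrices is, up to invertible
diagonal factors, the Fourier matrix ((-1)^{ef} q^{ij}), hence non-degenerate (`nondegenerate`).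
Non-degenerate blocks give H_l = H_r = H (`range_mul_range_eq_top`). If q is not primitive, then q^m
= 1 for some 0 < m < n, and the rows and columns of W at a^{2m} and at 1 are proportional on each
parity class. Then w¹ has two equal rows, and all of H_l H_r lies in the hyperplane where the
coordinates at e_{a^{2m}} and e_1 agree (`range_mul_range_ne_top`). So both minimality and
non-degeneracy are equivalent to primitivity of q. -/

namespace ExtensionData

/-! ### R-matrix axioms as scalar identities on the coefficients -/

section ParityForm

variable {k G : Type*} [Field k] [CommGroup G] [DecidableEq G] (D : ExtensionData k G)

/-- The parity of `g`: `false` on `S` and `true` on `T`. -/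
def par (g : G) : Bool := decide (D.act g ≠ g)

/-- The basis element `e_g` (for `p = false`) or `e_g x` (for `p = true`). -/
def basisElt (g : G) (p : Bool) : D.Alg := bif p then D.eX g else D.e g

/-- `g ◁ x^p`. -/
def actPow (g : G) (p : Bool) : G := bif p then D.act g else g

/-- The coefficient of `x^p x^q`: it is `c` if `p = q = 1`, and `1` otherwise. -/
def carry (c : kˣ) (p q : Bool) : k := bif p && q then (c : k) else 1

variable {D}

theorem par_act (g : G) : D.par (D.act g) = D.par g := by
  simp [par, D.act_act, eq_comm]

theorem par_actPow (g : G) (p : Bool) : D.par (D.actPow g p) = D.par g := by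
  cases p <;> simp [actPow, par_act]

theorem par_eq_false {g : G} : D.par g = false ↔ D.act g = g := by simp [par]

theorem par_eq_true {g : G} : D.par g = true ↔ D.act g ≠ g := by simp [par]

omit [DecidableEq G] in
theorem σ_actPow (g : G) (p : Bool) : D.σ (D.actPow g p) = D.σ g := by
  cases p <;> simp [actPow, D.σ_act]

omit [DecidableEq G] in
theorem actPow_actPow (g : G) (p : Bool) : D.actPow (D.actPow g p) p = g := by
  cases p <;> simp [actPow, D.act_act]

theorem basisElt_mul (g h : G) (p q : Bool) : D.basisElt g p * D.basisElt h q =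
    if h = D.actPow g p then carry (D.σ g) p q • D.basisElt g (xor p q) else 0 := by
  cases p <;> cases q <;>
    simp [basisElt, actPow, carry, e_mul_e, e_mul_eX, eX_mul_e, eX_mul_eX]

theorem sum_basisElt_false [Fintype G] : ∑ g, D.basisElt g false = (1 : D.Alg) := sum_e

theorem comul_basisElt [Fintype G] (g : G) (p : Bool) :
    Coalgebra.comul (R := k) (D.basisElt g p) =
      ∑ h, carry (D.τ h (h⁻¹ * g)) p true •
        (D.basisElt h p ⊗ₜ[k] D.basisElt (h⁻¹ * g) p) := by
  cases p
  · simpa [basisElt, carry] using comul_e (D := D) g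
  · have h : Coalgebra.comul (R := k) (D.eX g) = D.comulMap (D.eX g) := rfl
    simp [basisElt, carry, h, comulMap_eX]

variable (D)

/-- The element `∑ W(g, h) e_g x^{|h|} ⊗ e_h x^{|g|}` of `H ⊗ H`. -/
noncomputable def parityForm [Fintype G] (W : G → G → k) : D.Alg ⊗[k] D.Alg :=
  ∑ g, ∑ h, W g h • (D.basisElt g (D.par h) ⊗ₜ[k] D.basisElt h (D.par g))

/-- The function on `G × G` whose restrictions to `S × S`, `S × T`, `T × S`, `T × T` are given. -/
def glue (w₁ : Matrix D.S D.S k) (w₂ : Matrix D.S D.T k)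
    (w₃ : Matrix D.T D.S k) (w₄ : Matrix D.T D.T k) (g h : G) : k :=
  if hg : D.act g = g then
    if hh : D.act h = h then w₁ ⟨g, hg⟩ ⟨h, hh⟩ else w₂ ⟨g, hg⟩ ⟨h, hh⟩
  else
    if hh : D.act h = h then w₃ ⟨g, hg⟩ ⟨h, hh⟩ else w₄ ⟨g, hg⟩ ⟨h, hh⟩

variable {D} [Fintype G]

/-- In each of the four sums the exponent of x on one leg is the parity of the index on the other
leg, so the case distinction disappears. -/
theorem nontrivialForm_eq_parityForm (w₁ : Matrix D.S D.S k) (w₂ : Matrix D.S D.T k)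
    (w₃ : Matrix D.T D.S k) (w₄ : Matrix D.T D.T k) :
    D.nontrivialForm w₁ w₂ w₃ w₄ = D.parityForm (D.glue w₁ w₂ w₃ w₄) := by
  have hS : ∀ s : D.S, D.par s = false := fun s => par_eq_false.2 s.2
  have hT : ∀ t : D.T, D.par t = true := fun t => par_eq_true.2 t.2
  have key : ∀ {M : Type _} [AddCommMonoid M] (f : G → M),
      ∑ g, f g = ∑ s : D.S, f s + ∑ t : D.T, f t := fun f =>
    (Fintype.sum_subtype_add_sum_subtype (fun g => D.act g = g) f).symm
  rw [parityForm, key]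
  simp only [key (M := D.Alg ⊗[k] D.Alg), hS, hT, basisElt, cond_true, cond_false,
    nontrivialForm, e_mul_x, Finset.sum_add_distrib]
  have hs : ∀ s : D.S, D.act s = s := fun s => s.2
  have ht : ∀ t : D.T, D.act t ≠ t := fun t => t.2
  simp only [glue, hs, ht, dite_true, dite_false]
  abel

theorem legs13_parityForm (W : G → G → k) : legs13 (D.parityForm W) =
    ∑ g, ∑ h, W g h •
      (D.basisElt g (D.par h) ⊗ₜ[k] ((1 : D.Alg) ⊗ₜ[k] D.basisElt h (D.par g))) := by
  simp [legs13, parityForm]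

theorem legs12_parityForm (W : G → G → k) : legs12 (D.parityForm W) =
    ∑ g, ∑ h, W g h •
      (D.basisElt g (D.par h) ⊗ₜ[k] (D.basisElt h (D.par g) ⊗ₜ[k] (1 : D.Alg))) := by
  simp [legs12, parityForm]

theorem legs23_parityForm (W : G → G → k) : legs23 (D.parityForm W) =
    ∑ g, ∑ h, W g h •
      ((1 : D.Alg) ⊗ₜ[k] (D.basisElt g (D.par h) ⊗ₜ[k] D.basisElt h (D.par g))) := by
  simp [legs23, parityForm, TensorProduct.tmul_sum]

/-- `(Δ ⊗ id)(R) = R₁₃R₂₃` for `R = ∑ W(g, h) e_g x^{|h|} ⊗ e_h x^{|g|}`. -/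
theorem comul_left_parityForm {W : G → G → k}
    (hp : ∀ g h, D.par (g * h) = xor (D.par g) (D.par h))
    (hL : ∀ g h l, carry (D.τ g h) (D.par l) true * W (g * h) l =
      W g l * W h (D.actPow l (D.par g)) * carry (D.σ l) (D.par g) (D.par h)) :
    TensorProduct.assoc k D.Alg D.Alg D.Alg
      (LinearMap.rTensor D.Alg (Coalgebra.comul : D.Alg →ₗ[k] D.Alg ⊗[k] D.Alg)
        (D.parityForm W)) = legs13 (D.parityForm W) * legs23 (D.parityForm W) := by
  have lhs : TensorProduct.assoc k D.Alg D.Alg D.Alg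
      (LinearMap.rTensor D.Alg (Coalgebra.comul : D.Alg →ₗ[k] D.Alg ⊗[k] D.Alg)
        (D.parityForm W)) = ∑ g, ∑ h, ∑ l, (carry (D.τ g h) (D.par l) true * W (g * h) l) •
        (D.basisElt g (D.par l) ⊗ₜ[k] (D.basisElt h (D.par l) ⊗ₜ[k]
          D.basisElt l (xor (D.par g) (D.par h)))) := by
    simp only [parityForm, map_sum, map_smul, LinearMap.rTensor_tmul, comul_basisElt,
      TensorProduct.sum_tmul, TensorProduct.assoc_tmul, ← TensorProduct.smul_tmul',
      Finset.smul_sum, smul_smul]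
    rw [Finset.sum_congr rfl fun m _ => Finset.sum_comm, Finset.sum_comm]
    refine Finset.sum_congr rfl fun g _ => ?_
    refine Fintype.sum_equiv (Equiv.mulLeft g⁻¹) _ _ fun m => ?_
    refine Finset.sum_congr rfl fun l _ => ?_
    rw [Equiv.coe_mulLeft, mul_inv_cancel_left, ← hp, mul_inv_cancel_left, mul_comm]
  rw [lhs, legs13_parityForm, legs23_parityForm]
  simp only [Finset.sum_mul_sum, smul_mul_assoc, mul_smul_comm,
    Algebra.TensorProduct.tmul_mul_tmul, one_mul, mul_one]
  refine Finset.sum_congr rfl fun g _ => Finset.sum_congr rfl fun h _ =>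
    Finset.sum_congr rfl fun l _ => ?_
  -- Moving x^{|g|} past e_m leaves a nonzero product with e_l only for m = l ◁ x^{|g|}. This m has
  -- the parity of l, so the first two legs agree with the left-hand side.
  rw [Fintype.sum_eq_single (D.actPow l (D.par g)) fun m hm => by
    rw [basisElt_mul, if_neg hm, TensorProduct.tmul_zero, TensorProduct.tmul_zero, smul_zero,
      smul_zero], basisElt_mul, if_pos rfl, par_actPow]
  simp only [TensorProduct.tmul_smul, smul_smul]
  rw [hL]
  congr 1
  ring

/-- `(id ⊗ Δ)(R) = R₁₃R₁₂` for `R = ∑ W(g, h) e_g x^{|h|} ⊗ e_h x^{|g|}`. -/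
theorem comul_right_parityForm {W : G → G → k}
    (hp : ∀ g h, D.par (g * h) = xor (D.par g) (D.par h))
    (hR : ∀ g h l, carry (D.τ g h) (D.par l) true * W l (g * h) =
      W l h * W (D.actPow l (D.par h)) g * carry (D.σ l) (D.par h) (D.par g)) :
    LinearMap.lTensor D.Alg (Coalgebra.comul : D.Alg →ₗ[k] D.Alg ⊗[k] D.Alg)
      (D.parityForm W) = legs13 (D.parityForm W) * legs12 (D.parityForm W) := by
  have lhs : LinearMap.lTensor D.Alg (Coalgebra.comul : D.Alg →ₗ[k] D.Alg ⊗[k] D.Alg)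
      (D.parityForm W) = ∑ l, ∑ g, ∑ h, (carry (D.τ g h) (D.par l) true * W l (g * h)) •
        (D.basisElt l (xor (D.par h) (D.par g)) ⊗ₜ[k]
          (D.basisElt g (D.par l) ⊗ₜ[k] D.basisElt h (D.par l))) := by
    simp only [parityForm, map_sum, map_smul, LinearMap.lTensor_tmul, comul_basisElt,
      TensorProduct.tmul_sum, TensorProduct.tmul_smul, Finset.smul_sum, smul_smul]
    refine Finset.sum_congr rfl fun l _ => ?_
    rw [Finset.sum_comm]
    refine Finset.sum_congr rfl fun g _ => ?_
    refine Fintype.sum_equiv (Equiv.mulLeft g⁻¹) _ _ fun m => ?_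
    rw [Equiv.coe_mulLeft, mul_inv_cancel_left, Bool.xor_comm, ← hp, mul_inv_cancel_left,
      mul_comm]
  rw [lhs, legs13_parityForm, legs12_parityForm]
  simp only [Finset.sum_mul_sum, smul_mul_assoc, mul_smul_comm,
    Algebra.TensorProduct.tmul_mul_tmul, one_mul, mul_one]
  refine Finset.sum_congr rfl fun l _ => ?_
  rw [Finset.sum_comm]
  conv_rhs => rw [Finset.sum_comm]
  refine Finset.sum_congr rfl fun h _ => ?_
  rw [Fintype.sum_eq_single (D.actPow l (D.par h)) fun m hm => Finset.sum_eq_zero fun g _ => by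
    rw [basisElt_mul, if_neg hm, TensorProduct.zero_tmul, smul_zero, smul_zero]]
  refine Finset.sum_congr rfl fun g _ => ?_
  rw [basisElt_mul, if_pos rfl, par_actPow]
  simp only [← TensorProduct.smul_tmul', smul_smul]
  rw [hR]
  congr 1
  ring

variable (D) in
/-- The element `∑ F(u, v) e_u x^{a(u, v)} ⊗ e_v x^{b(u, v)}` of `H ⊗ H`. -/
noncomputable def basisForm (F : G → G → k) (a b : G → G → Bool) : D.Alg ⊗[k] D.Alg :=
  ∑ u, ∑ v, F u v • (D.basisElt u (a u v) ⊗ₜ[k] D.basisElt v (b u v))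

/-- Elements with one term for each pair (u, v) are closed under multiplication. The coproducts of
basis elements and R are of this kind, so the third axiom and invertibility can be checked at each
(u, v) separately. -/
theorem basisForm_mul (F F' : G → G → k) (a b a' b' : G → G → Bool) :
    D.basisForm F a b * D.basisForm F' a' b' = D.basisForm
      (fun u v => F u v * F' (D.actPow u (a u v)) (D.actPow v (b u v)) *
        (carry (D.σ u) (a u v) (a' (D.actPow u (a u v)) (D.actPow v (b u v))) *
        carry (D.σ v) (b u v) (b' (D.actPow u (a u v)) (D.actPow v (b u v)))))
      (fun u v => xor (a u v) (a' (D.actPow u (a u v)) (D.actPow v (b u v))))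
      (fun u v => xor (b u v) (b' (D.actPow u (a u v)) (D.actPow v (b u v)))) := by
  simp only [basisForm, Finset.sum_mul]
  refine Finset.sum_congr rfl fun u _ => Finset.sum_congr rfl fun v _ => ?_
  simp only [Finset.mul_sum, smul_mul_assoc, mul_smul_comm, Algebra.TensorProduct.tmul_mul_tmul]
  rw [Fintype.sum_eq_single (D.actPow u (a u v)) fun m hm => Finset.sum_eq_zero fun g _ => by
    rw [basisElt_mul, if_neg hm, TensorProduct.zero_tmul, smul_zero, smul_zero]]
  rw [Fintype.sum_eq_single (D.actPow v (b u v)) fun m hm => by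
    rw [basisElt_mul v m, if_neg hm, TensorProduct.tmul_zero, smul_zero, smul_zero]]
  rw [basisElt_mul, if_pos rfl, basisElt_mul, if_pos rfl]
  simp only [TensorProduct.tmul_smul, ← TensorProduct.smul_tmul', smul_smul]
  congr 1
  ring

theorem one_eq_basisForm :
    (1 : D.Alg ⊗[k] D.Alg) = D.basisForm (fun _ _ => 1) (fun _ _ => false) fun _ _ => false := by
  simp only [basisForm, one_smul, ← TensorProduct.tmul_sum, sum_basisElt_false]
  rw [← TensorProduct.sum_tmul, sum_basisElt_false, Algebra.TensorProduct.one_def]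

theorem comul_basisElt_eq_basisForm (g : G) (p : Bool) :
    Coalgebra.comul (R := k) (D.basisElt g p) = D.basisForm
      (fun u v => if u * v = g then carry (D.τ u v) p true else 0)
      (fun _ _ => p) fun _ _ => p := by
  rw [comul_basisElt, basisForm]
  refine Finset.sum_congr rfl fun u _ => ?_
  rw [Fintype.sum_eq_single (u⁻¹ * g) fun v hv => by
    rw [if_neg fun h => hv (by rw [← h]; group), zero_smul], if_pos (mul_inv_cancel_left u g)]

theorem comm_basisForm (F : G → G → k) (a b : G → G → Bool) :
    TensorProduct.comm k D.Alg D.Alg (D.basisForm F a b) =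
      D.basisForm (fun u v => F v u) (fun u v => b v u) fun u v => a v u := by
  simp only [basisForm, map_sum, map_smul, TensorProduct.comm_tmul]
  exact Finset.sum_comm

/-- `Δᵒᵖ(h) R = R Δ(h)` for `R = ∑ W(g, h) e_g x^{|h|} ⊗ e_h x^{|g|}`. -/
theorem comul_op_parityForm {W : G → G → k}
    (hp : ∀ g h, D.par (g * h) = xor (D.par g) (D.par h))
    (hC : ∀ g h, W (D.act g) (D.act h) * D.τ h g =
      W g h * D.τ (D.actPow g (D.par h)) (D.actPow h (D.par g))) (a : D.Alg) :
    TensorProduct.comm k D.Alg D.Alg (Coalgebra.comul a) * D.parityForm W =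
      D.parityForm W * Coalgebra.comul a := by
  -- This is the third axiom for e_g: moving Δ(e_g) past R must preserve the condition uv = g. If u
  -- and v are both odd, then uv is even, hence fixed by the action; in the remaining cases the
  -- acted elements are themselves fixed.
  have hact : ∀ u v, D.actPow u (D.par v) * D.actPow v (D.par u) = u * v := fun u v => by
    have h1 : D.par (u * v) = false → D.act u * D.act v = u * v := fun h => by
      rw [← map_mul]; exact par_eq_false.1 h
    have h2 : ∀ w, D.par w = false → D.act w = w := fun w => par_eq_false.1
    have h3 := hp u v
    cases hu : D.par u <;> cases hv : D.par v <;> simp_all [actPow]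
  have key : ∀ g p, TensorProduct.comm k D.Alg D.Alg (Coalgebra.comul (D.basisElt g p)) *
      D.parityForm W = D.parityForm W * Coalgebra.comul (D.basisElt g p) := by
    intro g p
    have hform : D.parityForm W = D.basisForm W (fun _ v => D.par v) fun u _ => D.par u := rfl
    rw [comul_basisElt_eq_basisForm, comm_basisForm, hform, basisForm_mul, basisForm_mul]
    refine Finset.sum_congr rfl fun u _ => Finset.sum_congr rfl fun v _ => ?_
    simp only [hact, par_actPow, mul_comm v u, Bool.xor_comm p]
    split_ifs
    · congr 1
      cases p
      · simp [carry, actPow]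
      · have := hC u v
        simp only [carry, actPow, Bool.true_and, Bool.and_true, cond_true] at this ⊢
        linear_combination ((bif D.par v then (D.σ u : k) else 1) *
          bif D.par u then (D.σ v : k) else 1) * this
    · simp
  have h2 : (LinearMap.mulRight k (D.parityForm W)) ∘ₗ
      (TensorProduct.comm k D.Alg D.Alg).toLinearMap ∘ₗ Coalgebra.comul =
      (LinearMap.mulLeft k (D.parityForm W)) ∘ₗ Coalgebra.comul :=
    hom_ext (fun g => key g false) fun g => key g true
  exact LinearMap.congr_fun h2 a

theorem isUnit_parityForm {W : G → G → k} (hW : ∀ g h, W g h ≠ 0) :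
    IsUnit (D.parityForm W) := by
  have hform : ∀ V, D.parityForm V = D.basisForm V (fun _ v => D.par v) fun u _ => D.par u :=
    fun _ => rfl
  have hc : ∀ (c : kˣ) p q, (carry c p q : k) ≠ 0 := fun c p q => by
    cases p <;> cases q <;> simp [carry]
  -- The inverse has the same shape: the term at (u, v) meets the term of R at (u ◁ x^{|v|}, v ◁
  -- x^{|u|}), and x² contributes the values of σ.
  refine isUnit_iff_exists.2 ⟨D.parityForm fun u v =>
    (W (D.actPow u (D.par v)) (D.actPow v (D.par u)) *
      (carry (D.σ u) (D.par v) (D.par v) * carry (D.σ v) (D.par u) (D.par u)))⁻¹, ?_, ?_⟩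
  all_goals
    rw [hform, hform, basisForm_mul, one_eq_basisForm]
    refine Finset.sum_congr rfl fun u _ => Finset.sum_congr rfl fun v _ => ?_
    simp only [par_actPow, actPow_actPow, σ_actPow, Bool.xor_self]
    congr 1
    have h1 := hc (D.σ u) (D.par v) (D.par v)
    have h2 := hc (D.σ v) (D.par u) (D.par u)
    have h3 := hW u v
    have h4 := hW (D.actPow u (D.par v)) (D.actPow v (D.par u))
    field_simp

/-- Conditions on `W` under which `∑ W(g, h) e_g x^{|h|} ⊗ e_h x^{|g|}` is a universal
R-matrix. -/
theorem isUniversalRMatrix_parityForm {W : G → G → k}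
    (hp : ∀ g h, D.par (g * h) = xor (D.par g) (D.par h)) (hW : ∀ g h, W g h ≠ 0)
    (hL : ∀ g h l, carry (D.τ g h) (D.par l) true * W (g * h) l =
      W g l * W h (D.actPow l (D.par g)) * carry (D.σ l) (D.par g) (D.par h))
    (hR : ∀ g h l, carry (D.τ g h) (D.par l) true * W l (g * h) =
      W l h * W (D.actPow l (D.par h)) g * carry (D.σ l) (D.par h) (D.par g))
    (hC : ∀ g h, W (D.act g) (D.act h) * D.τ h g =
      W g h * D.τ (D.actPow g (D.par h)) (D.actPow h (D.par g))) :
    IsUniversalRMatrix (D.parityForm W) :=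
  ⟨isUnit_parityForm hW, comul_left_parityForm hp hL, comul_right_parityForm hp hR,
    comul_op_parityForm hp hC⟩

end ParityForm
end ExtensionData

namespace ExtensionData

/-! ### The subspaces H_l and H_r, and minimality -/

section Contraction

variable {k G : Type*} [Field k] [CommGroup G] [DecidableEq G] (D : ExtensionData k G)

/-- The coordinate of `e_g x^p`. -/
def coord (g : G) (p : Bool) : D.Alg →ₗ[k] k := bif p then D.coordX g else D.coordE g

variable {D}

theorem coord_basisElt (g h : G) (p q : Bool) :
    D.coord g p (D.basisElt h q) = if h = g ∧ q = p then 1 else 0 := by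
  cases p <;> cases q <;>
    simp [coord, basisElt, coordE_e, coordE_eX, coordX_e, coordX_eX, eq_comm]

variable [Fintype G]

theorem leftContraction_parityForm (W : G → G → k) (f : Module.Dual k D.Alg) :
    leftContraction (D.parityForm W) f =
      ∑ g, ∑ h, (W g h * f (D.basisElt g (D.par h))) • D.basisElt h (D.par g) := by
  simp [leftContraction, parityForm, smul_smul]

theorem rightContraction_parityForm (W : G → G → k) (f : Module.Dual k D.Alg) :
    rightContraction (D.parityForm W) f =
      ∑ g, ∑ h, (W g h * f (D.basisElt h (D.par g))) • D.basisElt g (D.par h) := by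
  simp [rightContraction, parityForm, smul_smul]

variable (D) in
/-- The four blocks of `W`, as matrices indexed by `S × S`, `S × T`, `T × S`, `T × T`, have
trivial right kernels. -/
def BlocksSeparating (W : G → G → k) : Prop :=
  ∀ (p q : Bool) (φ : G → k),
    (∀ g, D.par g = p → ∑ h, (if D.par h = q then W g h * φ h else 0) = 0) →
      ∀ h, D.par h = q → φ h = 0

/-- A functional vanishing on `p` has, on the basis elements of a given index parity and x-exponent,
values in the right kernel of one block of W, so it is zero. The displayed vectors are the
contractions of R with the coordinate functionals of e_{g₀} x^q. -/
theorem eq_top_of_blocksSeparating {W : G → G → k} (hW : D.BlocksSeparating W)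
    {p : Submodule k D.Alg} (hp : ∀ g₀ q, ∑ h, (if D.par h = q then W g₀ h else 0) •
      D.basisElt h (D.par g₀) ∈ p) : p = ⊤ := by
  by_contra hne
  obtain ⟨φ, hφ, hle⟩ := Submodule.exists_le_ker_of_lt_top p (lt_top_iff_ne_top.2 hne)
  apply hφ
  have key : ∀ h r, φ (D.basisElt h r) = 0 := by
    intro h r
    refine hW r (D.par h) (fun h => φ (D.basisElt h r)) (fun g hg => ?_) h rfl
    have := hle (hp g (D.par h))
    rw [LinearMap.mem_ker, map_sum] at this
    refine Eq.trans (Finset.sum_congr rfl fun l _ => ?_) this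
    rw [map_smul, hg, smul_eq_mul, ite_mul, zero_mul]
  exact hom_ext (fun g => key g false) fun g => key g true

theorem range_leftContraction_parityForm {W : G → G → k} (hW : D.BlocksSeparating W) :
    LinearMap.range (leftContraction (D.parityForm W)) = ⊤ := by
  refine eq_top_of_blocksSeparating hW (fun g₀ q => ⟨D.coord g₀ q, ?_⟩)
  rw [leftContraction_parityForm, Fintype.sum_eq_single g₀ fun g hg => Finset.sum_eq_zero
    fun h _ => by rw [coord_basisElt, if_neg fun h => hg h.1, mul_zero, zero_smul]]
  refine Finset.sum_congr rfl fun h _ => ?_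
  rw [coord_basisElt]
  simp

theorem range_rightContraction_parityForm {W : G → G → k}
    (hW : D.BlocksSeparating fun g h => W h g) :
    LinearMap.range (rightContraction (D.parityForm W)) = ⊤ := by
  refine eq_top_of_blocksSeparating hW (fun g₀ q => ⟨D.coord g₀ q, ?_⟩)
  rw [rightContraction_parityForm, Finset.sum_comm, Fintype.sum_eq_single g₀ fun g hg =>
    Finset.sum_eq_zero
    fun h _ => by rw [coord_basisElt, if_neg fun h => hg h.1, mul_zero, zero_smul]]
  refine Finset.sum_congr rfl fun h _ => ?_
  rw [coord_basisElt]
  simp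

theorem sum_eq_sum_S_add_sum_T {M : Type*} [AddCommMonoid M] (f : G → M) :
    ∑ g, f g = ∑ s : D.S, f s + ∑ t : D.T, f t :=
  (Fintype.sum_subtype_add_sum_subtype (fun g => D.act g = g) f).symm

omit [Fintype G] in
theorem par_S (s : D.S) : D.par s = false := par_eq_false.2 s.2

omit [Fintype G] in
theorem par_T (t : D.T) : D.par t = true := par_eq_true.2 t.2

section glue

variable (w₁ : Matrix D.S D.S k) (w₂ : Matrix D.S D.T k) (w₃ : Matrix D.T D.S k)
  (w₄ : Matrix D.T D.T k)

omit [Fintype G]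

theorem glue_SS (s s' : D.S) : D.glue w₁ w₂ w₃ w₄ s s' = w₁ s s' := by
  simp [glue, s.2, s'.2]

theorem glue_ST (s : D.S) (t : D.T) : D.glue w₁ w₂ w₃ w₄ s t = w₂ s t := by
  simp [glue, s.2, t.2]

theorem glue_TS (t : D.T) (s : D.S) : D.glue w₁ w₂ w₃ w₄ t s = w₃ t s := by
  simp [glue, s.2, t.2]

theorem glue_TT (t t' : D.T) : D.glue w₁ w₂ w₃ w₄ t t' = w₄ t t' := by
  simp [glue, t.2, t'.2]

end glue

theorem blocksSeparating_glue {w₁ : Matrix D.S D.S k} {w₂ : Matrix D.S D.T k}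
    {w₃ : Matrix D.T D.S k} {w₄ : Matrix D.T D.T k} (h₁ : w₁.Nondegenerate)
    (h₂ : w₂.Nondegenerate) (h₃ : w₃.Nondegenerate) (h₄ : w₄.Nondegenerate) :
    D.BlocksSeparating (D.glue w₁ w₂ w₃ w₄) := by
  intro p q φ hφ h hh
  cases p <;> cases q
  · exact congr_fun (h₁.separatingRight.eq_zero_of_mulVec_eq_zero (v := fun s : D.S => φ s)
      (funext fun s => by
        simpa [sum_eq_sum_S_add_sum_T (D := D), par_S, par_T, glue_SS, Matrix.mulVec, dotProduct]
          using hφ s (par_S s))) ⟨h, par_eq_false.1 hh⟩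
  · exact congr_fun (h₂.separatingRight.eq_zero_of_mulVec_eq_zero (v := fun s : D.T => φ s)
      (funext fun s => by
        simpa [sum_eq_sum_S_add_sum_T (D := D), par_S, par_T, glue_ST, Matrix.mulVec, dotProduct]
          using hφ s (par_S s))) ⟨h, par_eq_true.1 hh⟩
  · exact congr_fun (h₃.separatingRight.eq_zero_of_mulVec_eq_zero (v := fun s : D.S => φ s)
      (funext fun s => by
        simpa [sum_eq_sum_S_add_sum_T (D := D), par_S, par_T, glue_TS, Matrix.mulVec, dotProduct]
          using hφ s (par_T s))) ⟨h, par_eq_false.1 hh⟩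
  · exact congr_fun (h₄.separatingRight.eq_zero_of_mulVec_eq_zero (v := fun s : D.T => φ s)
      (funext fun s => by
        simpa [sum_eq_sum_S_add_sum_T (D := D), par_S, par_T, glue_TT, Matrix.mulVec, dotProduct]
          using hφ s (par_T s))) ⟨h, par_eq_true.1 hh⟩

omit [Fintype G] in
theorem glue_swap (w₁ : Matrix D.S D.S k) (w₂ : Matrix D.S D.T k) (w₃ : Matrix D.T D.S k)
    (w₄ : Matrix D.T D.T k) : (fun g h => D.glue w₁ w₂ w₃ w₄ h g) =
      D.glue w₁.transpose w₃.transpose w₂.transpose w₄.transpose := by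
  funext g h
  simp only [glue, Matrix.transpose_apply]
  split_ifs <;> rfl

/-- A universal R-matrix of non-trivial form with non-degenerate blocks is minimal. -/
theorem range_mul_range_eq_top {w₁ : Matrix D.S D.S k} {w₂ : Matrix D.S D.T k}
    {w₃ : Matrix D.T D.S k} {w₄ : Matrix D.T D.T k} (h₁ : w₁.Nondegenerate)
    (h₂ : w₂.Nondegenerate) (h₃ : w₃.Nondegenerate) (h₄ : w₄.Nondegenerate) :
    LinearMap.range (leftContraction (D.nontrivialForm w₁ w₂ w₃ w₄)) *
      LinearMap.range (rightContraction (D.nontrivialForm w₁ w₂ w₃ w₄)) = ⊤ := by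
  rw [nontrivialForm_eq_parityForm,
    range_leftContraction_parityForm (blocksSeparating_glue h₁ h₂ h₃ h₄),
    range_rightContraction_parityForm
      (glue_swap w₁ w₂ w₃ w₄ ▸
        blocksSeparating_glue h₁.transpose h₃.transpose h₂.transpose h₄.transpose)]
  exact eq_top_iff.2 fun u _ => by
    simpa using Submodule.mul_mem_mul (Submodule.mem_top (x := u))
        (Submodule.mem_top (x := (1 : D.Alg)))

theorem sum_smul_basisElt_fst (F : G → G → k) (a : G → G → Bool) (c : G) :
    (∑ g, ∑ h, F g h • D.basisElt h (a g h)).1 c =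
      ∑ g, if a g c = false then F g c else 0 := by
  have : ∀ v : D.Alg, v.1 c = D.coord c false v := fun _ => rfl
  rw [this, map_sum]
  refine Finset.sum_congr rfl fun g _ => ?_
  simp only [map_sum, map_smul, coord_basisElt]
  rw [Fintype.sum_eq_single c fun h hh => by simp [hh]]
  simp

theorem sum_smul_basisElt_snd (F : G → G → k) (a : G → G → Bool) (c : G) :
    (∑ g, ∑ h, F g h • D.basisElt h (a g h)).2 c =
      ∑ g, if a g c = true then F g c else 0 := by
  have : ∀ v : D.Alg, v.2 c = D.coord c true v := fun _ => rfl
  rw [this, map_sum]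
  refine Finset.sum_congr rfl fun g _ => ?_
  simp only [map_sum, map_smul, coord_basisElt]
  rw [Fintype.sum_eq_single c fun h hh => by simp [hh]]
  simp

/-- If the rows and columns of `W` at some `c ∈ S`, `c ≠ 1`, agree with those at `1` up to a
factor `ω` on `T` with `ω² σ(c) = 1`, then `H_l H_r ≠ H`. -/
theorem range_mul_range_ne_top {W : G → G → k} {c : G} (hc : c ≠ 1) (hcS : D.act c = c) {ω : k}
    (hω : ω ^ 2 * D.σ c = 1)
    (hr : ∀ g, W c g = (bif D.par g then ω else 1) * W 1 g)
    (hl : ∀ g, W g c = (bif D.par g then ω else 1) * W g 1) :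
    LinearMap.range (leftContraction (D.parityForm W)) *
      LinearMap.range (rightContraction (D.parityForm W)) ≠ ⊤ := by
  intro htop
  have h1S : D.act 1 = 1 := map_one _
  have hpc : D.par c = false := par_eq_false.2 hcS
  have hp1 : D.par 1 = false := par_eq_false.2 h1S
  -- For c in S the coordinate of uv at e_c is u_c v_c + u'_c v'_c σ(c), where u', v' are the
  -- coordinates at e_c x. The plain coordinates come from even indices and agree with those at 1;
  -- the primed ones come from odd indices and each picks up ω. Since ω²σ(c) = 1 = σ(1), the
  -- coordinates of uv at c and at 1 agree.
  have hle : LinearMap.range (leftContraction (D.parityForm W)) *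
      LinearMap.range (rightContraction (D.parityForm W)) ≤
        LinearMap.ker (D.coordE c - D.coordE 1) := by
    refine Submodule.mul_le.2 ?_
    rintro _ ⟨f, rfl⟩ _ ⟨f', rfl⟩
    rw [leftContraction_parityForm, rightContraction_parityForm]
    rw [Finset.sum_comm (f := fun g h => (W g h * f' (D.basisElt h (D.par g))) •
      D.basisElt g (D.par h)), LinearMap.mem_ker, LinearMap.sub_apply, coordE_apply,
      coordE_apply, mul_fst, mul_fst, hcS, h1S]
    simp only [sum_smul_basisElt_fst, sum_smul_basisElt_snd, hpc, hp1, D.σ_one]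
    have e₁ : ∀ (f : G → k) (F : G → k), (∑ g, if D.par g = false then
        (bif D.par g then ω else 1) * F g * f g else 0) =
        ∑ g, if D.par g = false then F g * f g else 0 := fun f F =>
      Finset.sum_congr rfl fun g _ => by cases D.par g <;> simp
    have e₂ : ∀ (f : G → k) (F : G → k), (∑ g, if D.par g = true then
        (bif D.par g then ω else 1) * F g * f g else 0) =
        ω * ∑ g, if D.par g = true then F g * f g else 0 := fun f F => by
      rw [Finset.mul_sum]
      exact Finset.sum_congr rfl fun g _ => by cases D.par g <;> simp [mul_assoc]
    simp only [hl, hr, e₁ (fun g => f (D.basisElt g false)) (fun g => W g 1),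
      e₁ (fun g => f' (D.basisElt g false)) (fun g => W 1 g),
      e₂ (fun g => f (D.basisElt g false)) (fun g => W g 1),
      e₂ (fun g => f' (D.basisElt g false)) (fun g => W 1 g)]
    rw [Units.val_one]
    linear_combination ((∑ g, if D.par g = true then W g 1 * f (D.basisElt g false) else 0) *
      ∑ g, if D.par g = true then W 1 g * f' (D.basisElt g false) else 0) * hω
  have h1 : D.e c ∈ LinearMap.ker (D.coordE c - D.coordE 1) := hle (htop ▸ Submodule.mem_top)
  rw [LinearMap.mem_ker, LinearMap.sub_apply, coordE_e, coordE_e, if_pos rfl, if_neg hc.symm,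
    sub_zero] at h1
  exact one_ne_zero h1

end Contraction
end ExtensionData

/-! ### The group elements a^i b^e -/

namespace KGroup

variable {n : ℕ}

theorem a_pow_two_mul : a n ^ (2 * n) = 1 := by
  refine Prod.ext ?_ (one_pow _)
  change Multiplicative.ofAdd ((2 * n) • (1 : ZMod (2 * n))) = 1
  rw [nsmul_eq_mul, mul_one, ZMod.natCast_self, ofAdd_zero]

theorem b_mul_b : b n * b n = 1 := by
  refine Prod.ext (one_mul _) ?_
  change Multiplicative.ofAdd ((1 : ZMod 2) + 1) = 1
  rfl

theorem b_pow_mod (e : ℕ) : b n ^ (e % 2) = b n ^ e := by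
  conv_rhs => rw [← Nat.mod_add_div e 2, pow_add, pow_mul, pow_two, b_mul_b, one_pow, mul_one]

theorem a_pow_mul_b_pow_fst (i e : ℕ) :
    (a n ^ i * b n ^ e).1 = Multiplicative.ofAdd (i : ZMod (2 * n)) := by
  have h : (a n ^ i * b n ^ e).1 = Multiplicative.ofAdd (i • (1 : ZMod (2 * n))) * 1 ^ e := rfl
  rw [h, one_pow, mul_one, nsmul_eq_mul, mul_one]

theorem a_pow_mul_b_pow_snd (i e : ℕ) :
    (a n ^ i * b n ^ e).2 = Multiplicative.ofAdd (e : ZMod 2) := by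
  have h : (a n ^ i * b n ^ e).2 = 1 ^ i * Multiplicative.ofAdd (e • (1 : ZMod 2)) := rfl
  rw [h, one_pow, one_mul, nsmul_eq_mul, mul_one]

theorem exists_eq [NeZero n] (g : KGroup n) :
    ∃ i < 2 * n, ∃ e < 2, g = a n ^ i * b n ^ e := by
  refine ⟨(Multiplicative.toAdd g.1).val, ZMod.val_lt _, (Multiplicative.toAdd g.2).val,
    ZMod.val_lt _, Prod.ext ?_ ?_⟩
  · rw [a_pow_mul_b_pow_fst, ZMod.natCast_zmod_val]; rfl
  · rw [a_pow_mul_b_pow_snd, ZMod.natCast_zmod_val]; rfl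

theorem half_eq {i : ℕ} (hi : i < 2 * n) (e : ℕ) : half (a n ^ i * b n ^ e) = i / 2 := by
  rw [half, a_pow_mul_b_pow_fst, toAdd_ofAdd, ZMod.val_natCast, Nat.mod_eq_of_lt hi]

theorem isPowA_iff (i e : ℕ) : IsPowA (a n ^ i * b n ^ e) ↔ e % 2 = 0 := by
  rw [IsPowA, a_pow_mul_b_pow_snd]
  change ((e : ZMod 2) = 0) ↔ _
  rw [ZMod.natCast_eq_zero_iff, Nat.dvd_iff_mod_eq_zero]

theorem b_ne_one : b n ≠ 1 := fun h => by
  have : (1 : ZMod 2) = 0 := congr_arg (fun g : KGroup n => Multiplicative.toAdd g.2) h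
  exact one_ne_zero this

end KGroup

/-! ### Rescaling τ to a bicharacter and computing σ -/

namespace ExtensionData

open KGroup

variable {k : Type*} [Field k] {n : ℕ} {D : ExtensionData k (KGroup n)}

theorem τ_cocycle_coe {G : Type*} [CommGroup G] (D : ExtensionData k G) (g h l : G) :
    (D.τ g h * D.τ (g * h) l : k) = D.τ h l * D.τ g (h * l) := by
  exact_mod_cast congr_arg Units.val (D.τ_cocycle g h l)

theorem σ_mul_coe {G : Type*} [CommGroup G] (D : ExtensionData k G) (g h : G) :
    (D.σ (g * h) : k) = D.σ g * D.σ h * (D.τ g h * D.τ (D.act g) (D.act h)) := by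
  have h1 : D.σ (g * h) = D.σ g * D.σ h * (D.τ g h * D.τ (D.act g) (D.act h)) := by
    rw [← D.σ_mul]; rw [mul_comm (D.σ g), mul_assoc, mul_comm (D.σ (g * h)), mul_assoc]
    simp [mul_comm]
  exact_mod_cast congr_arg Units.val h1

/-- On an abelian group the commutator η of a 2-cocycle is multiplicative in each variable.
Denominators are cleared, and three instances of the cocycle identity are combined. -/
theorem τ_swap_mul {G : Type*} [CommGroup G] (D : ExtensionData k G) (g h l : G) :
    (D.τ l (g * h) : k) * D.τ g l * D.τ h l = D.τ (g * h) l * D.τ l g * D.τ l h := by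
  have h1 := D.τ_cocycle_coe l g h
  have h2 := D.τ_cocycle_coe g l h
  have h3 := D.τ_cocycle_coe g h l
  rw [mul_comm l g] at h1
  rw [mul_comm l h] at h2
  have n1 := (D.τ g h).ne_zero
  have n2 := (D.τ (g * l) h).ne_zero
  refine mul_right_cancel₀ (mul_ne_zero n1 n2) ?_
  linear_combination (-(D.τ g l : k) * D.τ h l * D.τ (g * l) h) * h1 +
    (D.τ l g * D.τ (g * l) h * D.τ h l : k) * h2 - (D.τ (g * l) h * D.τ l g * D.τ l h : k) * h3

/-- By multiplicativity of η, the single value η(a,b) = -1 gives η(a^i,b) = (-1)^i. -/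
theorem τ_b_a_pow (hη : D.η (a n) (b n) = -1) (i : ℕ) :
    (D.τ (b n) (a n ^ i) : k) = (-1) ^ i * D.τ (a n ^ i) (b n) := by
  have h0 : (D.τ (a n) (b n) : k) = - D.τ (b n) (a n) := by
    have := congr_arg Units.val (mul_inv_eq_iff_eq_mul.1 hη)
    simpa using this
  induction i with
  | zero => simp [D.τ_one_left, D.τ_one_right]
  | succ i ih =>
    have h1 := D.τ_swap_mul (a n ^ i) (a n) (b n)
    rw [ih, h0, ← pow_succ] at h1
    have n1 := (D.τ (a n ^ i) (b n)).ne_zero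
    have n2 := (D.τ (b n) (a n)).ne_zero
    refine mul_right_cancel₀ (mul_ne_zero n1 n2) ?_
    linear_combination -h1

theorem act_a_pow_mul_b_pow (hD : D.IsK) (i e : ℕ) :
    D.act (a n ^ i * b n ^ e) = a n ^ i * b n ^ (e + i) := by
  rw [map_mul, map_pow, map_pow, hD.1, hD.2, mul_pow, pow_add, mul_assoc, mul_comm (b n ^ i)]

theorem P_succ (i : ℕ) : D.P (i + 1) = D.P i * D.τ (a n) (a n ^ i) := by
  rcases i with _ | i
  · simp [P, D.τ_one_right]
  · rw [P, Finset.prod_Ico_succ_top (by omega), P]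

variable (D) in
/-- The scalars making `F(a^i b^e) u_{a^i b^e}` equal to `(u_a)^i (δ⁻¹ u_b)^e` in the twisted
group algebra with basis `u_g` and product `u_g u_h = τ(g, h) u_{gh}`, where `δ² = τ(b, b)`. -/
def gauge (δ : k) (i e : ℕ) : k :=
  D.P i * if e % 2 = 0 then 1 else D.τ (a n ^ i) (b n) * δ⁻¹

theorem gauge_even (δ : k) (i : ℕ) {e : ℕ} (he : e % 2 = 0) : D.gauge δ i e = D.P i := by
  rw [gauge, if_pos he, mul_one]

theorem gauge_odd (δ : k) (i : ℕ) {e : ℕ} (he : e % 2 = 1) :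
    D.gauge δ i e = D.P i * (D.τ (a n ^ i) (b n) * δ⁻¹) := by
  rw [gauge, if_neg (by omega)]

theorem gauge_congr (δ : k) (i : ℕ) {e f : ℕ} (h : e % 2 = f % 2) :
    D.gauge δ i e = D.gauge δ i f := by
  rw [gauge, gauge, h]

theorem gauge_ne_zero {δ : k} (hδ : δ ≠ 0) (i e : ℕ) : D.gauge δ i e ≠ 0 := by
  rw [gauge]
  split_ifs <;> simp [hδ]

theorem b_pow_even {e : ℕ} (he : e % 2 = 0) : b n ^ e = 1 := by
  rw [← b_pow_mod, he, pow_zero]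

theorem b_pow_odd {e : ℕ} (he : e % 2 = 1) : b n ^ e = b n := by
  rw [← b_pow_mod, he, pow_one]

/-- In the gauge `gauge`, the cocycle `τ` is the bicharacter `(a^i b^e, a^j b^f) ↦ (-1)^{ej}`. -/
theorem gauge_mul_gauge (hη : D.η (a n) (b n) = -1) {δ : k} (hδ : δ ≠ 0)
    (hδ2 : δ ^ 2 = D.τ (b n) (b n)) (i e j f : ℕ) :
    D.gauge δ i e * D.gauge δ j f * D.τ (a n ^ i * b n ^ e) (a n ^ j * b n ^ f) =
      (-1) ^ (e * j) * D.gauge δ (i + j) (e + f) := by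
  -- Both τ and the bicharacter are cocycles, so the formula for two left arguments implies it for
  -- their product. It remains to check the left arguments 1, a and b.
  have hsucc : ∀ i e i' e', (∀ j f, D.gauge δ i e * D.gauge δ j f *
      D.τ (a n ^ i * b n ^ e) (a n ^ j * b n ^ f) =
      (-1) ^ (e * j) * D.gauge δ (i + j) (e + f)) → (∀ j f, D.gauge δ i' e' * D.gauge δ j f *
      D.τ (a n ^ i' * b n ^ e') (a n ^ j * b n ^ f) =
      (-1) ^ (e' * j) * D.gauge δ (i' + j) (e' + f)) → (∀ j f, D.gauge δ (i + i') (e + e') *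
        D.gauge δ j f * D.τ (a n ^ (i + i') * b n ^ (e + e')) (a n ^ j * b n ^ f) =
      (-1) ^ ((e + e') * j) * D.gauge δ (i + i' + j) (e + e' + f)) := by
    intro i e i' e' h h' j f
    have h1 := h i' e'
    have h2 := h' j f
    have h3 := h (i' + j) (e' + f)
    have h4 := D.τ_cocycle_coe (a n ^ i * b n ^ e) (a n ^ i' * b n ^ e') (a n ^ j * b n ^ f)
    have hm : ∀ i e j f : ℕ, a n ^ i * b n ^ e * (a n ^ j * b n ^ f) =
        a n ^ (i + j) * b n ^ (e + f) := fun i e j f => by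
      rw [pow_add, pow_add, mul_mul_mul_comm]
    rw [hm, hm] at h4
    rw [← add_assoc, ← add_assoc] at h3
    have hs : ((-1 : k)) ^ (e * i') * (-1) ^ (e * i') = 1 := by
      rw [← mul_pow]; simp
    have e1 : D.gauge δ (i + i') (e + e') = (-1) ^ (e * i') * (D.gauge δ i e * D.gauge δ i' e' *
        D.τ (a n ^ i * b n ^ e) (a n ^ i' * b n ^ e')) := by
      rw [h1, ← mul_assoc, hs, one_mul]
    rw [e1]
    have e2 : ((-1 : k)) ^ ((e + e') * j) = (-1) ^ (e * i') * (-1) ^ (e' * j) *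
        (-1) ^ (e * (i' + j)) := by
      rw [mul_add, add_mul, pow_add, pow_add]
      linear_combination (-(-1 : k) ^ (e * j) * (-1) ^ (e' * j)) * hs
    rw [e2]
    linear_combination ((-1) ^ (e * i') * D.gauge δ i e * D.gauge δ i' e' * D.gauge δ j f : k) *
      h4 + ((-1) ^ (e * i') * D.gauge δ i e * D.τ (a n ^ i * b n ^ e)
        (a n ^ (i' + j) * b n ^ (e' + f)) : k) * h2 +
      ((-1 : k) ^ (e * i') * (-1) ^ (e' * j)) * h3
  have h00 : ∀ j f, D.gauge δ 0 0 * D.gauge δ j f *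
      D.τ (a n ^ 0 * b n ^ 0) (a n ^ j * b n ^ f) =
      (-1) ^ (0 * j) * D.gauge δ (0 + j) (0 + f) := by
    intro j f
    have : D.P 0 = 1 := rfl
    simp [gauge_even, this, D.τ_one_left]
  have h10 : ∀ j f, D.gauge δ 1 0 * D.gauge δ j f *
      D.τ (a n ^ 1 * b n ^ 0) (a n ^ j * b n ^ f) =
      (-1) ^ (0 * j) * D.gauge δ (1 + j) (0 + f) := by
    intro j f
    have h1 : D.P 1 = 1 := rfl
    simp only [zero_add, zero_mul, pow_zero, one_mul, pow_one, mul_one]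
    rw [add_comm 1 j, gauge_even _ _ rfl, h1, Units.val_one, one_mul]
    rcases Nat.mod_two_eq_zero_or_one f with hf | hf
    · rw [gauge_even _ _ hf, gauge_even _ _ hf, b_pow_even hf, P_succ, mul_one, Units.val_mul]
    · rw [gauge_odd _ _ hf, gauge_odd _ _ hf, b_pow_odd hf, P_succ, Units.val_mul]
      have := D.τ_cocycle_coe (a n) (a n ^ j) (b n)
      rw [← pow_succ'] at this
      linear_combination (-(D.P j : k) * δ⁻¹) * this
  -- The left argument b is the only place where η(a,b) = -1 and δ² = τ(b,b) enter.
  have h01 : ∀ j f, D.gauge δ 0 1 * D.gauge δ j f *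
      D.τ (a n ^ 0 * b n ^ 1) (a n ^ j * b n ^ f) =
      (-1) ^ (1 * j) * D.gauge δ (0 + j) (1 + f) := by
    intro j f
    have h1 : D.P 0 = 1 := rfl
    rw [zero_add, one_mul, pow_one, pow_zero, one_mul, gauge_odd _ 0 rfl, h1, pow_zero,
      D.τ_one_left, Units.val_one, one_mul, one_mul]
    rcases Nat.mod_two_eq_zero_or_one f with hf | hf
    · rw [gauge_even _ _ hf, gauge_odd _ _ (by omega), b_pow_even hf, mul_one, τ_b_a_pow hη]
      ring
    · rw [gauge_odd _ _ hf, gauge_even _ _ (by omega), b_pow_odd hf]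
      have c1 := D.τ_cocycle_coe (b n) (a n ^ j) (b n)
      have c2 := D.τ_cocycle_coe (a n ^ j) (b n) (b n)
      rw [b_mul_b, D.τ_one_right, Units.val_one, mul_one, ← hδ2] at c2
      rw [mul_comm (b n) (a n ^ j), τ_b_a_pow hη] at c1
      field_simp
      linear_combination (-1 : k) * c1 + (-1) ^ j * c2
  have hi0 : ∀ i : ℕ, ∀ j f, D.gauge δ i 0 * D.gauge δ j f *
      D.τ (a n ^ i * b n ^ 0) (a n ^ j * b n ^ f) =
      (-1) ^ (0 * j) * D.gauge δ (i + j) (0 + f) := fun i => by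
    induction i with
    | zero => exact h00
    | succ i ih => exact hsucc i 0 1 0 ih h10
  have h0e : ∀ e : ℕ, ∀ j f, D.gauge δ 0 e * D.gauge δ j f *
      D.τ (a n ^ 0 * b n ^ e) (a n ^ j * b n ^ f) =
      (-1) ^ (e * j) * D.gauge δ (0 + j) (e + f) := fun e => by
    induction e with
    | zero => exact h00
    | succ e ih => exact hsucc 0 e 0 1 ih h01
  have := hsucc i 0 0 e (hi0 i) (h0e e) j f
  simpa only [add_zero, zero_add] using this

/-- The value of `σ(a^i b^e)` in the gauge `gauge`. -/
def gaugeσ (c : k) (i : ℕ) : k := c ^ (i % 2) * (-c ^ 2) ^ (i / 2)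

/-- In closed form `gaugeσ c i` is (-1)^{i(i-1)/2} c^i. The sign (-1)^i is the one τ(ab, ·) produces
at each step of the induction in `σ_eq`. -/
theorem gaugeσ_succ (c : k) (i : ℕ) : gaugeσ c (i + 1) = (-1) ^ i * c * gaugeσ c i := by
  rcases Nat.even_or_odd' i with ⟨j, rfl | rfl⟩
  · have h1 : (2 * j + 1) / 2 = j := by omega
    simp [gaugeσ, h1]
  · have h1 : (2 * j + 1) / 2 = j := by omega
    have h2 : (2 * j + 1 + 1) / 2 = j + 1 := by omega
    have h3 : (2 * j + 1 + 1) % 2 = 0 := by omega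
    have h4 : (2 * j + 1) % 2 = 1 := by omega
    have h5 : (-1 : k) ^ (2 * j + 1) = -1 := Odd.neg_one_pow ⟨j, rfl⟩
    rw [gaugeσ, gaugeσ, h1, h2, h3, h4, h5]
    ring

/-- The relation between σ and τ determines σ(a·g) from σ(a) and σ(g), so σ is fixed by σ(a),
encoded in c, and by σ(b). The argument `e + i` is the exponent of b in (a^i b^e) ◁ x. -/
theorem σ_eq (hD : D.IsK) (hη : D.η (a n) (b n) = -1) {δ : k} (hδ : δ ≠ 0)
    (hδ2 : δ ^ 2 = D.τ (b n) (b n)) {c : k} (hc : c * D.τ (a n) (b n) = D.σ (a n) * δ)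
    (i e : ℕ) : (D.σ (a n ^ i * b n ^ e) : k) =
      gaugeσ c i * (D.gauge δ i e * D.gauge δ i (e + i)) := by
  have hmul := gauge_mul_gauge hη hδ hδ2
  have P0 : D.P 0 = 1 := rfl
  have P1 : D.P 1 = 1 := rfl
  induction i with
  | zero =>
    rw [pow_zero, one_mul, add_zero]
    rcases Nat.mod_two_eq_zero_or_one e with he | he
    · rw [b_pow_even he, gauge_even _ _ he, P0, D.σ_one]; simp [gaugeσ]
    · rw [b_pow_odd he, gauge_odd _ _ he, P0]
      -- The value σ(b) = τ(b,b)⁻¹ comes from σ(ab) = σ(a ◁ x) = σ(a), together with τ(a,b)τ(ab,b) =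
      -- τ(b,b).
      have h1 := D.σ_mul_coe (a n) (b n)
      rw [← hD.1, D.σ_act, hD.2, hD.1] at h1
      have h2 := D.τ_cocycle_coe (a n) (b n) (b n)
      rw [b_mul_b, D.τ_one_right, Units.val_one, mul_one, ← hδ2] at h2
      rw [h2] at h1
      have h3 : (D.σ (b n) : k) * δ ^ 2 = 1 :=
        mul_left_cancel₀ (D.σ (a n)).ne_zero (by linear_combination -h1)
      simp only [gaugeσ, pow_zero, D.τ_one_left, Units.val_one, Nat.zero_mod, Nat.zero_div,
        one_mul]
      field_simp
      exact h3
  | succ i ih =>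
    have h1 := D.σ_mul_coe (a n ^ 1 * b n ^ 0) (a n ^ i * b n ^ e)
    have h2 := hmul 1 0 i e
    have h3 := hmul 1 (0 + 1) i (e + i)
    rw [act_a_pow_mul_b_pow hD, act_a_pow_mul_b_pow hD, ih] at h1
    have h4 : a n ^ 1 * b n ^ 0 * (a n ^ i * b n ^ e) = a n ^ (i + 1) * b n ^ e := by
      rw [pow_one, pow_zero, mul_one, ← mul_assoc, pow_succ']
    rw [h4] at h1
    rw [h1, gaugeσ_succ]
    simp only [add_comm 1 i, zero_mul, zero_add, pow_zero, one_mul, pow_one, mul_one] at h1 h2 ⊢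
    rw [gauge_even _ _ rfl, P1, Units.val_one, one_mul] at h2
    rw [add_comm 1 i, zero_add, one_mul, gauge_odd _ 1 rfl, P1, Units.val_one, one_mul,
      show 1 + (e + i) = e + (i + 1) by ring, pow_one, pow_one] at h3
    rw [← h2]
    have h5 : (-1 : k) ^ i * (-1) ^ i = 1 := by rw [← mul_pow]; simp
    have h6 : D.gauge δ (i + 1) (e + (i + 1)) = (-1) ^ i * (D.τ (a n) (b n) * δ⁻¹ *
        D.gauge δ i (e + i) * D.τ (a n * b n) (a n ^ i * b n ^ (e + i))) := by
      rw [h3, ← mul_assoc, h5, one_mul]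
    have h7 : (D.σ (a n) : k) = c * (D.τ (a n) (b n) * δ⁻¹) := by
      field_simp; exact hc.symm
    rw [h6, h7]
    linear_combination (-(c * (D.τ (a n) (b n) * δ⁻¹) * (gaugeσ c i * (D.gauge δ i e *
      D.gauge δ i (e + i))) * (D.τ (a n) (a n ^ i * b n ^ e) *
      D.τ (a n * b n) (a n ^ i * b n ^ (e + i)))) : k) * h5

end ExtensionData

/-! ### The parameters δ, c, ζ, q and the ingredients of the four matrices -/

namespace ExtensionData

open KGroup

variable {k : Type*} [Field k] {n : ℕ} {D : ExtensionData k (KGroup n)}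

theorem b_pow_mul_eq_iff (hD : D.IsK) (i e : ℕ) :
    D.act (a n ^ i * b n ^ e) = a n ^ i * b n ^ e ↔ i % 2 = 0 := by
  rw [act_a_pow_mul_b_pow hD, mul_right_inj, pow_add, mul_eq_left]
  rcases Nat.mod_two_eq_zero_or_one i with hi | hi
  · simp [b_pow_even hi, hi]
  · simp [b_pow_odd hi, hi, b_ne_one]

theorem par_el (hD : D.IsK) (i e : ℕ) :
    D.par (a n ^ i * b n ^ e) = decide (i % 2 = 1) := by
  rw [par, decide_eq_decide, Ne, b_pow_mul_eq_iff hD]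
  omega

/-- The parameters of `R_{α,β}` in the gauge `gauge`. -/
structure GaugeParams (D : ExtensionData k (KGroup n)) (α β δ c ζ q : k) : Prop where
  isK : D.IsK
  η_eq : D.η (a n) (b n) = -1
  α_ne : α ≠ 0
  δ_ne : δ ≠ 0
  δ_sq : δ ^ 2 = D.τ (b n) (b n)
  β_eq : β * D.τ (a n) (b n) = α * δ
  c_eq : c * D.τ (a n) (b n) = D.σ (a n) * δ
  c_ne : c ≠ 0
  ζ_eq : ζ = c * α ^ 2
  q_eq : q = -(ζ ^ 2 * c ^ 2)
  ζ_pow : ζ ^ n = D.P (2 * n)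

/-- Since τ(a,b) = -τ(b,a), the second condition on α, β reads (βτ(a,b)/α)² = τ(b,b), so it supplies
the square root δ. The first reads (σ(a)αβ)^n = P_{2n}. Both parameters are nonzero because n ≥ 1.
-/
theorem IsAdmissible.gaugeParams [NeZero n] (hD : D.IsK) (hη : D.η (a n) (b n) = -1) {α β : k}
    (h : D.IsAdmissible α β) : D.GaugeParams α β (β * D.τ (a n) (b n) / α) (D.σ (a n) * β / α)
      (D.σ (a n) * α * β) (-((D.σ (a n) * α * β) ^ 2 * (D.σ (a n) * β / α) ^ 2)) := by
  have hn : n ≠ 0 := NeZero.ne n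
  have hα : α ≠ 0 := by rintro rfl; simpa [hn] using h.1
  have hβ : β ≠ 0 := by rintro rfl; simpa [hn] using h.1
  have hσ := (D.σ (a n)).ne_zero
  have hτ := (D.τ (a n) (b n)).ne_zero
  have hτ' := (D.τ (b n) (a n)).ne_zero
  have hτb : (D.τ (a n) (b n) : k) = -D.τ (b n) (a n) := by
    have := τ_b_a_pow hη 1
    rw [pow_one, pow_one] at this
    rw [this]
    ring
  have h1 := h.1
  have h2 := h.2
  refine ⟨hD, hη, hα, by simp [hα, hβ], ?_, by field_simp, by field_simp,
    by simp [hα, hβ], by field_simp, rfl, ?_⟩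
  · rw [hτb]
    field_simp at h2 ⊢
    linear_combination h2
  · rw [lam, Nat.mul_div_cancel_left n two_pos, pow_one] at h1
    push_cast at h1
    have hP := (D.P (2 * n)).ne_zero
    field_simp at h1
    rw [← h1]
    ring

/-- The normal form of the values of `R_{α,β}` in the gauge `gauge`. -/
def normalValue (α ζ q : k) (i e j f : ℕ) : k :=
  (-1) ^ (e * f + e * (j % 2) * (i % 2 + 1)) * q ^ ((i / 2) * (j / 2)) *
    ζ ^ ((i / 2) * (j % 2) + (j / 2) * (i % 2)) * α ^ ((i % 2) * (j % 2))

variable {α β δ c ζ q : k}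

namespace GaugeParams

theorem mul_τ (H : D.GaugeParams α β δ c ζ q) (i e j f : ℕ) :
    D.gauge δ i e * D.gauge δ j f * D.τ (a n ^ i * b n ^ e) (a n ^ j * b n ^ f) =
      (-1) ^ (e * j) * D.gauge δ (i + j) (e + f) :=
  gauge_mul_gauge H.η_eq H.δ_ne H.δ_sq i e j f

theorem σ_el (H : D.GaugeParams α β δ c ζ q) (i e : ℕ) : (D.σ (a n ^ i * b n ^ e) : k) =
    gaugeσ c i * (D.gauge δ i e * D.gauge δ i (e + i)) :=
  σ_eq H.isK H.η_eq H.δ_ne H.δ_sq H.c_eq i e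

theorem gauge_ne (H : D.GaugeParams α β δ c ζ q) (i e : ℕ) : D.gauge δ i e ≠ 0 :=
  gauge_ne_zero H.δ_ne i e

theorem ζ_ne (H : D.GaugeParams α β δ c ζ q) : ζ ≠ 0 := by
  rw [H.ζ_eq]
  exact mul_ne_zero H.c_ne (pow_ne_zero _ H.α_ne)

theorem q_ne (H : D.GaugeParams α β δ c ζ q) : q ≠ 0 := by
  rw [H.q_eq]
  exact neg_ne_zero.2 (mul_ne_zero (pow_ne_zero _ H.ζ_ne) (pow_ne_zero _ H.c_ne))

theorem ζ_eq' (H : D.GaugeParams α β δ c ζ q) : ζ = D.σ (a n) * α * β := by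
  have hτ := (D.τ (a n) (b n)).ne_zero
  refine mul_right_cancel₀ (mul_ne_zero hτ hτ) ?_
  rw [H.ζ_eq]
  linear_combination α ^ 2 * D.τ (a n) (b n) * H.c_eq -
    D.σ (a n) * α * D.τ (a n) (b n) * H.β_eq

theorem σ_even (H : D.GaugeParams α β δ c ζ q) (j : ℕ) :
    (D.σ (a n ^ (2 * j)) : k) = (-c ^ 2) ^ j * D.P (2 * j) ^ 2 := by
  have h := H.σ_el (2 * j) 0
  rw [pow_zero, mul_one, zero_add, gauge_even _ _ rfl, gauge_even _ _ (by omega)] at h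
  rw [h, gaugeσ, Nat.mul_mod_right, Nat.mul_div_cancel_left j two_pos]
  ring

theorem σ_odd (H : D.GaugeParams α β δ c ζ q) (j : ℕ) : (D.σ (a n ^ (2 * j + 1)) : k) =
    c * (-c ^ 2) ^ j * (D.gauge δ (2 * j + 1) 0 * D.gauge δ (2 * j + 1) 1) := by
  have h := H.σ_el (2 * j + 1) 0
  rw [pow_zero, mul_one, zero_add,
    gauge_congr _ _ (show (2 * j + 1) % 2 = 1 % 2 by omega)] at h
  rw [h, gaugeσ, show (2 * j + 1) % 2 = 1 by omega, show (2 * j + 1) / 2 = j by omega, pow_one]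

theorem q_pow (H : D.GaugeParams α β δ c ζ q) (j : ℕ) : q ^ j = ζ ^ (2 * j) * (-c ^ 2) ^ j := by
  rw [H.q_eq, pow_mul, ← mul_pow]
  ring

/-- Evaluating σ at a^{2n} = 1 gives (-c²)^n P_{2n}² = 1, and P_{2n} = ζ^n. -/
theorem q_pow_n (H : D.GaugeParams α β δ c ζ q) : q ^ n = 1 := by
  have h := H.σ_even n
  rw [a_pow_two_mul, D.σ_one, ← H.ζ_pow, Units.val_one] at h
  rw [H.q_pow, h]
  ring

theorem S₀_eq (H : D.GaugeParams α β δ c ζ q) (j : ℕ) :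
    D.S₀ α β j = ζ ^ j * α / D.gauge δ (2 * j + 1) 0 := by
  rw [S₀, lam, gauge_even _ _ rfl, show (2 * j + 1) / 2 = j by omega, H.ζ_eq', pow_one]
  push_cast
  field_simp
  ring

/-- `S₀` and `S₁` are the coefficients of R at (a, a^{2j+1}) and (a, a^{2j+1}b). After rescaling
they coincide: the factor h and the ratio β/α account exactly for the change of gauge between
a^{2j+1} and a^{2j+1}b. -/
theorem S₁_eq (H : D.GaugeParams α β δ c ζ q) (j : ℕ) :
    D.S₁ α β j = ζ ^ j * α / D.gauge δ (2 * j + 1) 1 := by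
  have hact : D.act (a n) = a n ^ 1 * b n ^ 1 := by rw [H.isK.1, pow_one, pow_one]
  have hact' : D.act (a n ^ (2 * j + 1) * b n) = a n ^ (2 * j + 1) * b n ^ 0 := by
    have := act_a_pow_mul_b_pow H.isK (2 * j + 1) 1
    rwa [pow_one, b_pow_even (e := 1 + (2 * j + 1)) (by omega), ← pow_zero (b n)] at this
  have h1 := H.mul_τ 1 0 (2 * j + 1) 1
  have h2 := H.mul_τ (2 * j + 1) 0 1 1
  rw [← hact', ← hact, add_comm (2 * j + 1) 1, add_comm 0 1] at h2
  have hP1 : D.P 1 = 1 := rfl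
  simp only [zero_mul, pow_zero, one_mul, pow_one, mul_one, zero_add, add_zero] at h1 h2
  rw [← h2, gauge_even _ 1 rfl, hP1, Units.val_one, one_mul] at h1
  rw [S₁, hh, lam, show (2 * j + 1) / 2 = j by omega]
  have hg := H.gauge_ne (2 * j + 1) 1
  have hg1 : D.gauge δ 1 1 = D.τ (a n) (b n) * δ⁻¹ := by
    rw [gauge_odd _ _ rfl, hP1, Units.val_one, one_mul, pow_one]
  have hP : D.gauge δ (2 * j + 1) 0 = D.P (2 * j + 1) := gauge_even _ _ rfl
  rw [hg1, hP] at h1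
  have hδ := H.δ_ne
  rw [H.ζ_eq', pow_one]
  push_cast
  rw [eq_div_iff hg]
  have hn1 := (D.τ (D.act (a n ^ (2 * j + 1) * b n)) (D.act (a n))).ne_zero
  have hn2 := (D.P (2 * j + 1)).ne_zero
  field_simp at h1 ⊢
  have hβ := H.β_eq
  refine mul_right_cancel₀ hδ ?_
  linear_combination (D.σ (a n) ^ j * α ^ j * β ^ (j + 1) : k) * h1 + (D.P (2 * j + 1) *
    D.τ (D.act (a n ^ (2 * j + 1) * b n)) (D.act (a n)) * (D.σ (a n) * α * β) ^ j : k) * hβ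

theorem w₁_val (H : D.GaugeParams α β δ c ζ q) (i j : ℕ) :
    (D.lam (2 * j) 1 : k) ^ (2 * i) * (α * β) ^ (2 * i * j) * (D.σ (a n ^ (2 * j)) : k) ^ i =
      q ^ (i * j) := by
  have h : (D.lam (2 * j) 1 : k) ^ 2 * (α * β) ^ (2 * j) * D.σ (a n ^ (2 * j)) = q ^ j := by
    rw [lam, H.σ_even, H.q_pow, H.ζ_eq', Nat.mul_div_cancel_left j two_pos, pow_one]
    push_cast
    field_simp
    ring
  rw [mul_comm i j, pow_mul q, ← h]
  ring

/-- The gauge factors of σ(a^{2j+1}) cancel those of `S₀` and `S₁`, leaving cα² · ζ^{2j}(-c²)^j.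
This is the quantity whose i-th power occurs in w², w³ and w⁴. -/
theorem S₀_mul_S₁ (H : D.GaugeParams α β δ c ζ q) (j : ℕ) :
    (D.σ (a n ^ (2 * j + 1)) : k) * (D.S₀ α β j * D.S₁ α β j) = ζ * q ^ j := by
  have h0 := H.gauge_ne (2 * j + 1) 0
  have h1 := H.gauge_ne (2 * j + 1) 1
  rw [H.S₀_eq, H.S₁_eq, H.σ_odd, H.q_pow]
  field_simp
  rw [H.ζ_eq]
  ring

theorem lam_even_mul (H : D.GaugeParams α β δ c ζ q) (i j : ℕ) :
    (D.lam (2 * i) (2 * j + 1) : k) * (D.S₀ α β j * D.S₁ α β j) ^ i =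
      (ζ * q ^ j) ^ i / D.P (2 * i) := by
  rw [← H.S₀_mul_S₁, lam, Nat.mul_div_cancel_left i two_pos]
  push_cast
  field_simp
  ring

theorem lam_odd_mul (H : D.GaugeParams α β δ c ζ q) (i j : ℕ) :
    (D.lam (2 * i + 1) (2 * j + 1) : k) * (D.S₀ α β j * D.S₁ α β j) ^ i =
      (ζ * q ^ j) ^ i / D.P (2 * i + 1) := by
  rw [← H.S₀_mul_S₁, lam, show (2 * i + 1) / 2 = i by omega]
  push_cast
  field_simp
  ring

/-- The right-hand side is minus the ratio of the gauges at a^{2i} and a^{2i}b. -/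
theorem d_eq (H : D.GaugeParams α β δ c ζ q) (i : ℕ) :
    D.τ (b n) (a n) * β / (D.τ (b n) (a n ^ (2 * i)) * α) = -δ / D.τ (a n ^ (2 * i)) (b n) := by
  have h1 := τ_b_a_pow H.η_eq 1
  have h2 := τ_b_a_pow H.η_eq (2 * i)
  rw [pow_mul (-1 : k), neg_one_sq, one_pow, one_mul] at h2
  rw [pow_one, pow_one] at h1
  rw [h1, h2]
  have := H.α_ne
  field_simp
  linear_combination -H.β_eq

end GaugeParams
end ExtensionData

/-! ### The coefficients of R in normal form -/

namespace ExtensionData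

open KGroup

variable {k : Type*} [Field k] {n : ℕ} {D : ExtensionData k (KGroup n)}

variable (D) in
/-- The coefficient function of `R_{α,β}` on `G × G`. -/
def coeffR (α β : k) : KGroup n → KGroup n → k :=
  D.glue (D.w₁ α β) (D.w₂ α β) (D.w₃ α β) (D.w₄ α β)

variable {α β δ c ζ q : k}

namespace GaugeParams

/-- For odd t₁, t₂ the product t₁t₂ is even, hence fixed by the action. So τ(t₁,t₂) and τ(t₂ ◁ x, t₁
◁ x) involve the same gauge of the product, which cancels in the quotient. -/
theorem hh_odd (H : D.GaugeParams α β δ c ζ q) (i j f : ℕ) :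
    (D.hh (a n ^ (2 * i + 1) * b n ^ 1) (a n ^ (2 * j + 1) * b n ^ f) : k) =
      (-1) ^ f * (D.gauge δ (2 * j + 1) (f + 1) * D.gauge δ (2 * i + 1) 0) /
        (D.gauge δ (2 * i + 1) 1 * D.gauge δ (2 * j + 1) f) := by
  have h1 := H.mul_τ (2 * i + 1) 1 (2 * j + 1) f
  have h2 := H.mul_τ (2 * j + 1) (f + (2 * j + 1)) (2 * i + 1) (1 + (2 * i + 1))
  have n1 := H.gauge_ne (2 * i + 1) 0
  have n2 := H.gauge_ne (2 * i + 1) 1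
  have n3 := H.gauge_ne (2 * j + 1) f
  have n4 := H.gauge_ne (2 * j + 1) (f + 1)
  have n5 := (D.τ (a n ^ (2 * j + 1) * b n ^ (f + (2 * j + 1)))
    (a n ^ (2 * i + 1) * b n ^ (1 + (2 * i + 1)))).ne_zero
  have e1 : (-1 : k) ^ (1 * (2 * j + 1)) = -1 := Odd.neg_one_pow ⟨j, by ring⟩
  have e2 : (-1 : k) ^ ((f + (2 * j + 1)) * (2 * i + 1)) = -(-1) ^ f := by
    rw [show (f + (2 * j + 1)) * (2 * i + 1) = 2 * (f * i + 2 * j * i + i + j) + f + 1 by ring,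
      pow_succ, pow_add, pow_mul]
    simp
  have e3 : (-1 : k) ^ f * (-1) ^ f = 1 := by rw [← mul_pow]; simp
  rw [e1] at h1
  rw [e2, gauge_congr (e := f + (2 * j + 1)) (f := f + 1) _ _ (by omega),
    gauge_congr (e := 1 + (2 * i + 1)) (f := 0) _ _ (by omega),
    gauge_congr (e := f + (2 * j + 1) + (1 + (2 * i + 1))) (f := 1 + f) _ _ (by omega),
    show 2 * j + 1 + (2 * i + 1) = 2 * i + 1 + (2 * j + 1) by ring] at h2
  rw [hh, act_a_pow_mul_b_pow H.isK, act_a_pow_mul_b_pow H.isK, Units.val_div_eq_div_val,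
    div_eq_div_iff n5 (mul_ne_zero n2 n3)]
  linear_combination h1 - (-1 : k) ^ f * h2 + D.gauge δ (2 * i + 1 + (2 * j + 1)) (1 + f) * e3

/-- The values of `R_{α,β}` in the gauge `gauge`, on representatives of the elements of `G`. -/
theorem coeffR_of_lt (H : D.GaugeParams α β δ c ζ q) {i e j f : ℕ} (hi : i < 2 * n) (he : e < 2)
    (hj : j < 2 * n) (hf : f < 2) :
    D.coeffR α β (a n ^ i * b n ^ e) (a n ^ j * b n ^ f) *
      (D.gauge δ i e ^ (j % 2) * D.gauge δ j f ^ (i % 2)) = normalValue α ζ q i e j f := by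
  have hpow : ∀ e < 2, IsPowA (a n ^ i * b n ^ e) ↔ e = 0 := fun e he => by
    rw [isPowA_iff, Nat.mod_eq_of_lt he]
  have hpow' : ∀ e < 2, IsPowA (a n ^ j * b n ^ e) ↔ e = 0 := fun e he => by
    rw [isPowA_iff, Nat.mod_eq_of_lt he]
  have hP : ∀ i, D.gauge δ i 0 = D.P i := fun i => gauge_even _ _ rfl
  have hP1 : ∀ i, D.gauge δ i 1 = D.P i * (D.τ (a n ^ i) (b n) * δ⁻¹) := fun i =>
    gauge_odd _ _ rfl
  have hg0 : ∀ i, D.gauge δ i 0 ≠ 0 := fun i => H.gauge_ne i 0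
  have hg1 : ∀ i, D.gauge δ i 1 ≠ 0 := fun i => H.gauge_ne i 1
  have hg2 : ∀ i, D.gauge δ i 2 = D.gauge δ i 0 := fun i => gauge_congr _ _ rfl
  have hδ := H.δ_ne
  rw [coeffR, glue]
  rcases Nat.even_or_odd' i with ⟨i, rfl | rfl⟩ <;> rcases Nat.even_or_odd' j with ⟨j, rfl | rfl⟩
  · have m1 : 2 * i / 2 = i := by omega
    have m2 : 2 * j / 2 = j := by omega
    rw [dif_pos ((b_pow_mul_eq_iff H.isK _ _).2 (by omega)),
      dif_pos ((b_pow_mul_eq_iff H.isK _ _).2 (by omega))]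
    simp only [w₁, half_eq hi, half_eq hj, hpow e he, hpow' f hf, m1, m2, H.w₁_val, normalValue,
      Nat.mul_mod_right, pow_zero, mul_one, mul_zero, zero_mul, add_zero]
    interval_cases e <;> interval_cases f <;> simp
  · have m1 : 2 * i / 2 = i := by omega
    have m2 : (2 * j + 1) / 2 = j := by omega
    have m3 : (2 * j + 1) % 2 = 1 := by omega
    rw [dif_pos ((b_pow_mul_eq_iff H.isK _ _).2 (by omega)),
      dif_neg (mt (b_pow_mul_eq_iff H.isK _ _).1 (by omega))]
    simp only [w₂, half_eq hi, half_eq hj, hpow e he, hpow' f hf, m1, m2, m3, H.lam_even_mul,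
      H.d_eq, normalValue, Nat.mul_mod_right, pow_zero, pow_one, mul_one, mul_zero,
      add_zero, zero_add]
    interval_cases e <;> interval_cases f <;> simp [hP, hP1] <;> field_simp <;> ring
  · have m1 : (2 * i + 1) / 2 = i := by omega
    have m2 : 2 * j / 2 = j := by omega
    have m3 : (2 * i + 1) % 2 = 1 := by omega
    rw [dif_neg (mt (b_pow_mul_eq_iff H.isK _ _).1 (by omega)),
      dif_pos ((b_pow_mul_eq_iff H.isK _ _).2 (by omega))]
    simp only [w₃, half_eq hi, half_eq hj, hpow e he, hpow' f hf, m1, m2, m3, H.lam_even_mul,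
      H.d_eq, normalValue, Nat.mul_mod_right, pow_zero, pow_one, mul_one, mul_zero, zero_mul,
      add_zero, zero_add]
    interval_cases e <;> interval_cases f <;> simp [hP, hP1] <;> field_simp <;> ring
  · have m1 : (2 * i + 1) / 2 = i := by omega
    have m2 : (2 * j + 1) / 2 = j := by omega
    have m3 : (2 * i + 1) % 2 = 1 := by omega
    have m4 : (2 * j + 1) % 2 = 1 := by omega
    rw [dif_neg (mt (b_pow_mul_eq_iff H.isK _ _).1 (by omega)),
      dif_neg (mt (b_pow_mul_eq_iff H.isK _ _).1 (by omega))]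
    -- Splitting off (S_{j,0}S_{j,1})^i leaves a single factor S_{j,0} here and S_{j,1} in `hc₁`.
    have hc₀ : (D.lam (2 * i + 1) (2 * j + 1) : k) * D.S₀ α β j ^ (i + 1) * D.S₁ α β j ^ i =
        (ζ * q ^ j) ^ i / D.gauge δ (2 * i + 1) 0 *
          (ζ ^ j * α / D.gauge δ (2 * j + 1) 0) := by
      rw [hP, ← H.lam_odd_mul, ← H.S₀_eq]
      ring
    have hc₁ : (D.lam (2 * i + 1) (2 * j + 1) : k) * D.S₀ α β j ^ i * D.S₁ α β j ^ (i + 1) =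
        (ζ * q ^ j) ^ i / D.gauge δ (2 * i + 1) 0 *
          (ζ ^ j * α / D.gauge δ (2 * j + 1) 1) := by
      rw [hP, ← H.lam_odd_mul, ← H.S₁_eq]
      ring
    simp only [w₄, half_eq hi, half_eq hj, hpow e he, hpow' f hf, m1, m2, m3, m4, hc₀, hc₁,
      normalValue, pow_one, mul_one]
    interval_cases e <;> interval_cases f <;>
      simp only [H.hh_odd, if_true, if_false, one_ne_zero] <;>
      simp only [hg2, zero_add, mul_one, mul_zero, pow_zero, pow_one, zero_mul, add_zero,
        one_add_one_eq_two] <;>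
      field_simp [hg0, hg1] <;> ring

theorem gauge_add_period (H : D.GaugeParams α β δ c ζ q) (i e : ℕ) :
    D.gauge δ (i + 2 * n) e = ζ ^ n * D.gauge δ i e := by
  have h := H.mul_τ (2 * n) 0 i e
  rw [a_pow_two_mul, pow_zero, mul_one, D.τ_one_left, Units.val_one, mul_one, zero_mul, pow_zero,
    one_mul, zero_add, gauge_even _ _ rfl, ← H.ζ_pow, add_comm] at h
  exact h.symm

theorem normalValue_add_left (H : D.GaugeParams α β δ c ζ q) (i e j f : ℕ) :
    normalValue α ζ q (i + 2 * n) e j f =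
      ζ ^ (n * (j % 2)) * normalValue α ζ q i e j f := by
  have h1 : (i + 2 * n) % 2 = i % 2 := by omega
  have h2 : (i + 2 * n) / 2 = i / 2 + n := by omega
  have h3 : q ^ (n * (j / 2)) = 1 := by rw [pow_mul, H.q_pow_n, one_pow]
  rw [normalValue, normalValue, h1, h2, add_mul (i / 2), pow_add q, h3]
  ring

theorem normalValue_add_right (H : D.GaugeParams α β δ c ζ q) (i e j f : ℕ) :
    normalValue α ζ q i e (j + 2 * n) f =
      ζ ^ (n * (i % 2)) * normalValue α ζ q i e j f := by
  have h1 : (j + 2 * n) % 2 = j % 2 := by omega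
  have h2 : (j + 2 * n) / 2 = j / 2 + n := by omega
  have h3 : q ^ (i / 2 * n) = 1 := by rw [mul_comm, pow_mul, H.q_pow_n, one_pow]
  rw [normalValue, normalValue, h1, h2, mul_add (i / 2), pow_add q, h3]
  ring

/-- The values of `R_{α,β}` in the gauge `gauge`. -/
theorem coeffR_mul [NeZero n] (H : D.GaugeParams α β δ c ζ q) (i e j f : ℕ) :
    D.coeffR α β (a n ^ i * b n ^ e) (a n ^ j * b n ^ f) *
      (D.gauge δ i e ^ (j % 2) * D.gauge δ j f ^ (i % 2)) = normalValue α ζ q i e j f := by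
  have hn : 0 < 2 * n := Nat.mul_pos two_pos (NeZero.pos n)
  have hsign : ∀ e, (-1 : k) ^ (e % 2) = (-1) ^ e := fun e => (neg_one_pow_eq_pow_mod_two e).symm
  have red_e : ∀ i e j f, normalValue α ζ q i (e % 2) j (f % 2) = normalValue α ζ q i e j f := by
    intro i e j f
    rw [normalValue, normalValue, ← hsign, ← hsign (e * f + _)]
    congr 4
    simp [Nat.add_mod, Nat.mul_mod]
  have hper : ∀ r i, a n ^ (i + 2 * n * r) = a n ^ i := fun r i => by
    rw [pow_add, pow_mul, a_pow_two_mul, one_pow, mul_one]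
  -- Neither the gauge nor the normal value is 2n-periodic in the exponents of a, but both acquire
  -- the same power of ζ^n = P_{2n}; the powers of q return because q^n = 1. The formula thus holds
  -- for all natural exponents, and products in G can be computed by adding exponents without
  -- reduction.
  have step : ∀ r s i e j f, D.coeffR α β (a n ^ i * b n ^ e) (a n ^ j * b n ^ f) *
      (D.gauge δ i e ^ (j % 2) * D.gauge δ j f ^ (i % 2)) = normalValue α ζ q i e j f →
      D.coeffR α β (a n ^ (i + 2 * n * r) * b n ^ e) (a n ^ (j + 2 * n * s) * b n ^ f) *
      (D.gauge δ (i + 2 * n * r) e ^ ((j + 2 * n * s) % 2) *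
        D.gauge δ (j + 2 * n * s) f ^ ((i + 2 * n * r) % 2)) =
        normalValue α ζ q (i + 2 * n * r) e (j + 2 * n * s) f := by
    intro r s i e j f h
    have m1 : ∀ i r, (i + 2 * n * r) % 2 = i % 2 := fun i r => by
      rw [mul_assoc]; omega
    induction r with
    | zero =>
      rw [mul_zero, add_zero]
      induction s with
      | zero => simpa using h
      | succ s ih =>
        rw [hper, m1] at ih ⊢
        rw [show j + 2 * n * (s + 1) = j + 2 * n * s + 2 * n by ring, H.normalValue_add_right,
          H.gauge_add_period, ← ih]
        ring
    | succ r ih =>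
      rw [hper, hper, m1, m1] at ih ⊢
      rw [show i + 2 * n * (r + 1) = i + 2 * n * r + 2 * n by ring, H.normalValue_add_left,
        H.gauge_add_period, ← ih, m1]
      ring
  have base := H.coeffR_of_lt (Nat.mod_lt i hn) (Nat.mod_lt e two_pos) (Nat.mod_lt j hn)
    (Nat.mod_lt f two_pos)
  have := step (i / (2 * n)) (j / (2 * n)) _ _ _ _ base
  rw [Nat.mod_add_div, Nat.mod_add_div, b_pow_mod, b_pow_mod, red_e,
    gauge_congr (e := e % 2) (f := e) _ _ (Nat.mod_mod _ _),
    gauge_congr (e := f % 2) (f := f) _ _ (Nat.mod_mod _ _)] at this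
  exact this

theorem normalValue_ne_zero (H : D.GaugeParams α β δ c ζ q) (i e j f : ℕ) :
    normalValue α ζ q i e j f ≠ 0 := by
  have := H.α_ne
  have := H.ζ_ne
  have := H.q_ne
  simp [normalValue, *]

/-- The values of `R_{α,β}`. -/
theorem coeffR_eq [NeZero n] (H : D.GaugeParams α β δ c ζ q) (i e j f : ℕ) :
    D.coeffR α β (a n ^ i * b n ^ e) (a n ^ j * b n ^ f) = normalValue α ζ q i e j f /
      (D.gauge δ i e ^ (j % 2) * D.gauge δ j f ^ (i % 2)) := by
  rw [eq_div_iff (mul_ne_zero (pow_ne_zero _ (H.gauge_ne _ _)) (pow_ne_zero _ (H.gauge_ne _ _))),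
    H.coeffR_mul]

theorem coeffR_ne_zero [NeZero n] (H : D.GaugeParams α β δ c ζ q) (g h : KGroup n) :
    D.coeffR α β g h ≠ 0 := by
  obtain ⟨i, -, e, -, rfl⟩ := KGroup.exists_eq g
  obtain ⟨j, -, f, -, rfl⟩ := KGroup.exists_eq h
  exact left_ne_zero_of_mul (H.coeffR_mul i e j f ▸ H.normalValue_ne_zero i e j f)

end GaugeParams
end ExtensionData

/-! ### The scalar identities for the coefficients of R -/

namespace ExtensionData

open KGroup

variable {k : Type*} [Field k] {n : ℕ} {D : ExtensionData k (KGroup n)}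

variable {α β δ c ζ q : k}

namespace GaugeParams

theorem gaugeσ_even (c : k) (j : ℕ) : gaugeσ c (2 * j) = (-c ^ 2) ^ j := by
  rw [gaugeσ, Nat.mul_mod_right, Nat.mul_div_cancel_left j two_pos, pow_zero, one_mul]

theorem gaugeσ_odd (c : k) (j : ℕ) : gaugeσ c (2 * j + 1) = c * (-c ^ 2) ^ j := by
  rw [gaugeσ, show (2 * j + 1) % 2 = 1 by omega, show (2 * j + 1) / 2 = j by omega, pow_one]

section normalValue

variable (α ζ q) (i e j f : ℕ)

theorem normalValue_ee :
    normalValue α ζ q (2 * i) e (2 * j) f = (-1) ^ (e * f) * q ^ (i * j) := by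
  simp [normalValue]

theorem normalValue_eo : normalValue α ζ q (2 * i) e (2 * j + 1) f =
    (-1) ^ (e * f + e) * q ^ (i * j) * ζ ^ i := by
  simp [normalValue, show (2 * j + 1) % 2 = 1 by omega, show (2 * j + 1) / 2 = j by omega]

theorem normalValue_oe : normalValue α ζ q (2 * i + 1) e (2 * j) f =
    (-1) ^ (e * f) * q ^ (i * j) * ζ ^ j := by
  simp [normalValue, show (2 * i + 1) % 2 = 1 by omega, show (2 * i + 1) / 2 = i by omega]

theorem normalValue_oo : normalValue α ζ q (2 * i + 1) e (2 * j + 1) f =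
    (-1) ^ (e * f) * q ^ (i * j) * ζ ^ (i + j) * α := by
  -- The extra term in the sign exponent is e for i even and j odd, is even here, and vanishes for
  -- even j.
  rw [normalValue, show e * f + e * ((2 * j + 1) % 2) * ((2 * i + 1) % 2 + 1) = e * f + e * 2 by
    rw [show (2 * i + 1) % 2 = 1 by omega, show (2 * j + 1) % 2 = 1 by omega, mul_one],
    pow_add _ (e * f), pow_mul' _ e]
  simp [ show (2 * i + 1) % 2 = 1 by omega, show (2 * i + 1) / 2 = i by omega,
    show (2 * j + 1) % 2 = 1 by omega, show (2 * j + 1) / 2 = j by omega, pow_add]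

end normalValue

theorem neg_one_pow_mul_odd (e i : ℕ) : (-1 : k) ^ (e * (2 * i + 1)) = (-1) ^ e := by
  rw [mul_add, pow_add, mul_left_comm, pow_mul]
  simp

theorem neg_one_pow_mul_even (e i : ℕ) : (-1 : k) ^ (e * (2 * i)) = 1 := by
  rw [mul_left_comm, pow_mul]
  simp

theorem τ_el (H : D.GaugeParams α β δ c ζ q) (i e j f : ℕ) :
    (D.τ (a n ^ i * b n ^ e) (a n ^ j * b n ^ f) : k) =
      (-1) ^ (e * j) * D.gauge δ (i + j) (e + f) / (D.gauge δ i e * D.gauge δ j f) := by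
  rw [eq_div_iff (mul_ne_zero (H.gauge_ne _ _) (H.gauge_ne _ _)), ← H.mul_τ]
  ring

theorem actPow_el (H : D.GaugeParams α β δ c ζ q) (i e : ℕ) (p : Bool) :
    D.actPow (a n ^ i * b n ^ e) p = a n ^ i * b n ^ (bif p then e + i else e) := by
  cases p
  · rfl
  · exact act_a_pow_mul_b_pow H.isK i e

theorem el_mul_el (i e j f : ℕ) : a n ^ i * b n ^ e * (a n ^ j * b n ^ f) =
    a n ^ (i + j) * b n ^ (e + f) := by
  rw [pow_add, pow_add, mul_mul_mul_comm]

theorem par_mul (H : D.GaugeParams α β δ c ζ q) [NeZero n] (g h : KGroup n) :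
    D.par (g * h) = xor (D.par g) (D.par h) := by
  obtain ⟨i, -, e, -, rfl⟩ := KGroup.exists_eq g
  obtain ⟨j, -, f, -, rfl⟩ := KGroup.exists_eq h
  rw [el_mul_el, par_el H.isK, par_el H.isK, par_el H.isK]
  rcases Nat.mod_two_eq_zero_or_one i with hi | hi <;>
    rcases Nat.mod_two_eq_zero_or_one j with hj | hj <;> simp [Nat.add_mod, hi, hj]

theorem coeffR_mul_left [NeZero n] (H : D.GaugeParams α β δ c ζ q) (g h l : KGroup n) :
    carry (D.τ g h) (D.par l) true * D.coeffR α β (g * h) l =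
      D.coeffR α β g l * D.coeffR α β h (D.actPow l (D.par g)) *
        carry (D.σ l) (D.par g) (D.par h) := by
  obtain ⟨i, -, e, he, rfl⟩ := KGroup.exists_eq g
  obtain ⟨i', -, e', he', rfl⟩ := KGroup.exists_eq h
  obtain ⟨j, -, f, hf, rfl⟩ := KGroup.exists_eq l
  have hF := H.gauge_ne
  rw [H.actPow_el, el_mul_el, par_el H.isK, par_el H.isK, par_el H.isK]
  have mo : ∀ i, (2 * i + 1) % 2 = 1 := fun i => by omega
  have a1 : ∀ i i', 2 * i + 1 + (2 * i' + 1) = 2 * (i + i' + 1) := fun i i' => by ring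
  have a2 : ∀ i i', 2 * i + 1 + 2 * i' = 2 * (i + i') + 1 := fun i i' => by ring
  have a3 : ∀ i i', 2 * i + (2 * i' + 1) = 2 * (i + i') + 1 := fun i i' => by ring
  have a4 : ∀ i i', 2 * i + 2 * i' = 2 * (i + i') := fun i i' => by ring
  have g1 : ∀ j f i, D.gauge δ j (f + 2 * i) = D.gauge δ j f := fun j f i =>
    gauge_congr _ _ (by omega)
  have g2 : ∀ j f i, D.gauge δ j (f + (2 * i + 1)) = D.gauge δ j (f + 1) := fun j f i =>
    gauge_congr _ _ (by omega)
  rcases Nat.even_or_odd' i with ⟨i, rfl | rfl⟩ <;>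
    rcases Nat.even_or_odd' i' with ⟨i', rfl | rfl⟩ <;>
    rcases Nat.even_or_odd' j with ⟨j, rfl | rfl⟩ <;>
    simp only [mo, Nat.mul_mod_right, zero_ne_one, decide_true, decide_false, cond_true,
      cond_false, carry, Bool.and_true, Bool.and_false, Bool.and_self, one_mul,
      mul_one] <;>
    simp only [H.coeffR_eq, H.τ_el, H.σ_el, a1, a2, a3, a4, normalValue_ee, normalValue_eo,
      normalValue_oe, normalValue_oo, g1, g2, gaugeσ_even, gaugeσ_odd, mo, Nat.mul_mod_right,
      pow_zero, pow_one, one_mul, mul_one, neg_one_pow_mul_odd, neg_one_pow_mul_even] <;>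
    simp only [mul_add, add_mul, mul_one, one_mul, pow_add, pow_one, neg_one_pow_mul_even] <;>
    field_simp (disch := exact hF _ _)
  -- Two odd exponents add up to 2(i + i' + 1); the carry produces an extra q^j, which matches
  -- ζ^{2j} from the two coefficients times (-c²)^j from σ.
  case inr.inr.inl =>
    rw [H.q_pow j]
    ring1
  -- Besides the extra q^j, the carry produces an extra ζ, matched by α² from the two coefficients
  -- and c from σ at an odd element. This is where ζ = cα² is needed.
  case inr.inr.inr =>
    rw [H.q_pow j]
    simp only [H.ζ_eq]
    first | ring1 | (interval_cases e <;> interval_cases e' <;> ring1)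
  all_goals
    first | ring1 | (interval_cases e <;> interval_cases e' <;> ring1)

theorem coeffR_mul_right [NeZero n] (H : D.GaugeParams α β δ c ζ q) (g h l : KGroup n) :
    carry (D.τ g h) (D.par l) true * D.coeffR α β l (g * h) =
      D.coeffR α β l h * D.coeffR α β (D.actPow l (D.par h)) g *
        carry (D.σ l) (D.par h) (D.par g) := by
  obtain ⟨i, -, e, he, rfl⟩ := KGroup.exists_eq g
  obtain ⟨i', -, e', he', rfl⟩ := KGroup.exists_eq h
  obtain ⟨j, -, f, hf, rfl⟩ := KGroup.exists_eq l
  have hF := H.gauge_ne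
  rw [H.actPow_el, el_mul_el, par_el H.isK, par_el H.isK, par_el H.isK]
  have mo : ∀ i, (2 * i + 1) % 2 = 1 := fun i => by omega
  have a1 : ∀ i i', 2 * i + 1 + (2 * i' + 1) = 2 * (i + i' + 1) := fun i i' => by ring
  have a2 : ∀ i i', 2 * i + 1 + 2 * i' = 2 * (i + i') + 1 := fun i i' => by ring
  have a3 : ∀ i i', 2 * i + (2 * i' + 1) = 2 * (i + i') + 1 := fun i i' => by ring
  have a4 : ∀ i i', 2 * i + 2 * i' = 2 * (i + i') := fun i i' => by ring
  have g1 : ∀ j f i, D.gauge δ j (f + 2 * i) = D.gauge δ j f := fun j f i =>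
    gauge_congr _ _ (by omega)
  have g2 : ∀ j f i, D.gauge δ j (f + (2 * i + 1)) = D.gauge δ j (f + 1) := fun j f i =>
    gauge_congr _ _ (by omega)
  have s1 : ∀ e j : ℕ, (-1 : k) ^ (2 * j * e) = 1 := fun e j => by
    rw [mul_comm, neg_one_pow_mul_even]
  have s2 : ∀ j : ℕ, (-1 : k) ^ (2 * j) = 1 := fun j => by rw [pow_mul]; simp
  rcases Nat.even_or_odd' i with ⟨i, rfl | rfl⟩ <;>
    rcases Nat.even_or_odd' i' with ⟨i', rfl | rfl⟩ <;>
    rcases Nat.even_or_odd' j with ⟨j, rfl | rfl⟩ <;>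
    simp only [mo, Nat.mul_mod_right, zero_ne_one, decide_true, decide_false, cond_true,
      cond_false, carry, Bool.and_true, Bool.and_false, Bool.and_self, one_mul,
      mul_one] <;>
    simp only [H.coeffR_eq, H.τ_el, H.σ_el, a1, a2, a3, a4, normalValue_ee, normalValue_eo,
      normalValue_oe, normalValue_oo, g1, g2, gaugeσ_even, gaugeσ_odd, mo, Nat.mul_mod_right,
      pow_zero, pow_one, one_mul, mul_one, neg_one_pow_mul_odd, neg_one_pow_mul_even] <;>
    simp only [mul_add, add_mul, mul_one, one_mul, pow_add, pow_one, s1, s2] <;>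
    field_simp (disch := exact hF _ _)
  case inr.inr.inl =>
    rw [mul_comm j i, mul_comm j i', H.q_pow j]
    interval_cases f <;> ring1
  case inr.inr.inr =>
    rw [H.q_pow j]
    simp only [H.ζ_eq]
    ring1

theorem coeffR_act [NeZero n] (H : D.GaugeParams α β δ c ζ q) (g h : KGroup n) :
    D.coeffR α β (D.act g) (D.act h) * D.τ h g =
      D.coeffR α β g h * D.τ (D.actPow g (D.par h)) (D.actPow h (D.par g)) := by
  obtain ⟨i, -, e, he, rfl⟩ := KGroup.exists_eq g
  obtain ⟨j, -, f, hf, rfl⟩ := KGroup.exists_eq h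
  have hF := H.gauge_ne
  rw [H.actPow_el, H.actPow_el, par_el H.isK, par_el H.isK, act_a_pow_mul_b_pow H.isK,
    act_a_pow_mul_b_pow H.isK, H.τ_el, H.τ_el, H.coeffR_eq, H.coeffR_eq, add_comm j i,
    add_comm f e]
  have mo : ∀ i, (2 * i + 1) % 2 = 1 := fun i => by omega
  have g1 : ∀ j f i, D.gauge δ j (f + 2 * i) = D.gauge δ j f := fun j f i =>
    gauge_congr _ _ (by omega)
  have g2 : ∀ j f i, D.gauge δ j (f + (2 * i + 1)) = D.gauge δ j (f + 1) := fun j f i =>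
    gauge_congr _ _ (by omega)
  have g3 : ∀ l i e j f, D.gauge δ l (e + (2 * i + 1) + (f + (2 * j + 1))) =
    D.gauge δ l (e + f) := fun l i e j f => gauge_congr _ _ (by omega)
  have g4 : ∀ l i e f, D.gauge δ l (e + (f + 2 * i)) =
    D.gauge δ l (e + f) := fun l i e f => gauge_congr _ _ (by omega)
  have g5 : ∀ l i e f, D.gauge δ l (e + 2 * i + f) =
    D.gauge δ l (e + f) := fun l i e f => gauge_congr _ _ (by omega)
  have s1 : ∀ e j : ℕ, (-1 : k) ^ (2 * j * e) = 1 := fun e j => by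
    rw [mul_comm, neg_one_pow_mul_even]
  have s2 : ∀ j : ℕ, (-1 : k) ^ (2 * j) = 1 := fun j => by rw [pow_mul]; simp
  rcases Nat.even_or_odd' i with ⟨i, rfl | rfl⟩ <;>
    rcases Nat.even_or_odd' j with ⟨j, rfl | rfl⟩ <;>
    simp only [mo, Nat.mul_mod_right, zero_ne_one, decide_true, decide_false, cond_true,
      cond_false] <;>
    simp only [normalValue_ee, normalValue_eo,
      normalValue_oe, normalValue_oo, g1, g2, g3, g4, g5,
      pow_zero, pow_one, one_mul, mul_one, neg_one_pow_mul_odd, neg_one_pow_mul_even] <;>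
    simp only [mul_add, add_mul, mul_one, one_mul, pow_add, pow_one, neg_one_pow_mul_even,
      s1, s2] <;>
    field_simp (disch := exact hF _ _) <;>
    interval_cases e <;> interval_cases f <;> ring

end GaugeParams
end ExtensionData

/-! ### Fourier matrices of Z/n × Z/2 -/

section Fourier

variable {k : Type*} [Field k] {n : ℕ} {q : k}

/-- The sums u(j,0) + u(j,1) and the differences u(j,0) - u(j,1) are each killed by the Vandermonde
matrix with the distinct nodes q^j; dividing by 2 recovers u. -/
theorem eq_zero_of_fourier_eq_zero (hq : IsPrimitiveRoot q n) (h2 : (2 : k) ≠ 0)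
    {u : Fin n × Fin 2 → k} (hu : ∀ x : Fin n × Fin 2, ∑ y : Fin n × Fin 2,
      (-1) ^ ((x.2 : ℕ) * y.2) * q ^ ((x.1 : ℕ) * y.1) * u y = 0) : u = 0 := by
  have hinj : Function.Injective fun j : Fin n => q ^ (j : ℕ) := fun i j h =>
    Fin.ext (hq.pow_inj i.2 j.2 h)
  have h0 := Matrix.eq_zero_of_forall_pow_sum_mul_pow_eq_zero
    (v := fun j => u (j, 0) + u (j, 1)) hinj fun i => by
      rw [← hu (i, 0), Fintype.sum_prod_type]
      refine Finset.sum_congr rfl fun j _ => ?_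
      rw [Fin.sum_univ_two]
      simp only [Fin.val_zero, zero_mul, pow_zero]
      ring
  have h1 := Matrix.eq_zero_of_forall_pow_sum_mul_pow_eq_zero
    (v := fun j => u (j, 0) - u (j, 1)) hinj fun i => by
      rw [← hu (i, 1), Fintype.sum_prod_type]
      refine Finset.sum_congr rfl fun j _ => ?_
      rw [Fin.sum_univ_two]
      simp only [Fin.val_zero, Fin.val_one, mul_zero, mul_one, pow_zero, pow_one]
      ring
  funext ⟨j, f⟩
  have e0 : u (j, 0) + u (j, 1) = 0 := congr_fun h0 j
  have e1 : u (j, 0) - u (j, 1) = 0 := congr_fun h1 j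
  have z0 : u (j, 0) = 0 := mul_left_cancel₀ h2 (by linear_combination e0 + e1)
  have z1 : u (j, 1) = 0 := mul_left_cancel₀ h2 (by linear_combination e0 - e1)
  fin_cases f
  · exact z0
  · exact z1

theorem separatingRight_of_fourier {X Y : Type*} [Fintype X] [Fintype Y]
    (eX : Fin n × Fin 2 ≃ X) (eY : Fin n × Fin 2 ≃ Y) (hq : IsPrimitiveRoot q n)
    (h2 : (2 : k) ≠ 0) {M : Matrix X Y k} {A B : Fin n × Fin 2 → k} (hA : ∀ x, A x ≠ 0)
    (hB : ∀ y, B y ≠ 0) (hM : ∀ x y, M (eX x) (eY y) =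
      A x * B y * ((-1) ^ ((x.2 : ℕ) * y.2) * q ^ ((x.1 : ℕ) * y.1))) : M.SeparatingRight := by
  refine Matrix.separatingRight_iff_forall_mulVec_eq_zero.2 fun v hv => ?_
  have hu := eq_zero_of_fourier_eq_zero hq h2 (u := fun y => B y * v (eY y)) fun x => by
    have h := congr_fun hv (eX x)
    rw [Matrix.mulVec, dotProduct, ← eY.sum_comp] at h
    refine mul_left_cancel₀ (hA x) ?_
    rw [mul_zero, Finset.mul_sum, ← Pi.zero_apply (M := fun _ : X => k) (eX x), ← h]
    refine Finset.sum_congr rfl fun y _ => ?_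
    rw [hM]
    ring
  funext y
  have := congr_fun hu (eY.symm y)
  simpa [hB] using this

/-- The hypothesis is symmetric under transposition with A and B exchanged, so one-sided separation
suffices. -/
theorem nondegenerate_of_fourier {X Y : Type*} [Fintype X] [Fintype Y]
    (eX : Fin n × Fin 2 ≃ X) (eY : Fin n × Fin 2 ≃ Y) (hq : IsPrimitiveRoot q n)
    (h2 : (2 : k) ≠ 0) {M : Matrix X Y k} {A B : Fin n × Fin 2 → k} (hA : ∀ x, A x ≠ 0)
    (hB : ∀ y, B y ≠ 0) (hM : ∀ x y, M (eX x) (eY y) =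
      A x * B y * ((-1) ^ ((x.2 : ℕ) * y.2) * q ^ ((x.1 : ℕ) * y.1))) : M.Nondegenerate := by
  refine ⟨Matrix.separatingRight_transpose_iff.1 ?_,
    separatingRight_of_fourier eX eY hq h2 hA hB hM⟩
  refine separatingRight_of_fourier eY eX hq h2 hB hA fun y x => ?_
  rw [Matrix.transpose_apply, hM, mul_comm (x.2 : ℕ), mul_comm (x.1 : ℕ), mul_comm (A x)]

end Fourier

/-! ### Non-degeneracy, minimality and primitivity of q -/

namespace ExtensionData

open KGroup

variable {k : Type*} [Field k] {n : ℕ} {D : ExtensionData k (KGroup n)}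

theorem el_injective {i e j f : ℕ} (hi : i < 2 * n) (hj : j < 2 * n) (he : e < 2) (hf : f < 2)
    (h : a n ^ i * b n ^ e = a n ^ j * b n ^ f) : i = j ∧ e = f := by
  have h1 := congr_arg (fun g : KGroup n => (Multiplicative.toAdd g.1).val) h
  have h2 := congr_arg (fun g : KGroup n => (Multiplicative.toAdd g.2).val) h
  simp only [a_pow_mul_b_pow_fst, a_pow_mul_b_pow_snd, toAdd_ofAdd, ZMod.val_natCast,
    Nat.mod_eq_of_lt hi, Nat.mod_eq_of_lt hj] at h1 h2
  omega

/-- The parametrization of `S` by `(i, e) ↦ a^{2i} b^e`. -/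
noncomputable def equivS [NeZero n] (hD : D.IsK) : Fin n × Fin 2 ≃ D.S :=
  Equiv.ofBijective (fun x => ⟨a n ^ (2 * (x.1 : ℕ)) * b n ^ (x.2 : ℕ),
    (b_pow_mul_eq_iff hD _ _).2 (by omega)⟩) <| by
  refine ⟨fun x y h => ?_, fun s => ?_⟩
  · have := el_injective (by omega) (by omega) x.2.2 y.2.2 (congr_arg Subtype.val h)
    exact Prod.ext (Fin.ext (by omega)) (Fin.ext (by omega))
  · obtain ⟨i, hi, e, he, h⟩ := KGroup.exists_eq s.1
    have hs := s.2
    rw [h, b_pow_mul_eq_iff hD] at hs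
    refine ⟨(⟨i / 2, by omega⟩, ⟨e, he⟩), Subtype.ext ?_⟩
    rw [h]
    simp only
    rw [show 2 * (i / 2) = i by omega]

/-- The parametrization of `T` by `(i, e) ↦ a^{2i+1} b^e`. -/
noncomputable def equivT [NeZero n] (hD : D.IsK) : Fin n × Fin 2 ≃ D.T :=
  Equiv.ofBijective (fun x => ⟨a n ^ (2 * (x.1 : ℕ) + 1) * b n ^ (x.2 : ℕ),
    mt (b_pow_mul_eq_iff hD _ _).1 (by omega)⟩) <| by
  refine ⟨fun x y h => ?_, fun s => ?_⟩
  · have := el_injective (by omega) (by omega) x.2.2 y.2.2 (congr_arg Subtype.val h)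
    exact Prod.ext (Fin.ext (by omega)) (Fin.ext (by omega))
  · obtain ⟨i, hi, e, he, h⟩ := KGroup.exists_eq s.1
    have hs := s.2
    rw [h, Ne, b_pow_mul_eq_iff hD] at hs
    refine ⟨(⟨i / 2, by omega⟩, ⟨e, he⟩), Subtype.ext ?_⟩
    rw [h]
    simp only
    rw [show 2 * (i / 2) + 1 = i by omega]

theorem equivS_coe [NeZero n] (hD : D.IsK) (x : Fin n × Fin 2) :
    (equivS hD x : KGroup n) = a n ^ (2 * (x.1 : ℕ)) * b n ^ (x.2 : ℕ) := rfl

theorem equivT_coe [NeZero n] (hD : D.IsK) (x : Fin n × Fin 2) :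
    (equivT hD x : KGroup n) = a n ^ (2 * (x.1 : ℕ) + 1) * b n ^ (x.2 : ℕ) := rfl

variable {α β δ c ζ q : k}

namespace GaugeParams

theorem nondegenerate [NeZero n] (H : D.GaugeParams α β δ c ζ q) (h2 : (2 : k) ≠ 0)
    (hq : IsPrimitiveRoot q n) : (D.w₁ α β).Nondegenerate ∧ (D.w₂ α β).Nondegenerate ∧
      (D.w₃ α β).Nondegenerate ∧ (D.w₄ α β).Nondegenerate := by
  have hζ := H.ζ_ne
  have hα := H.α_ne
  have hF := H.gauge_ne
  have mo : ∀ i, (2 * i + 1) % 2 = 1 := fun i => by omega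
  refine ⟨nondegenerate_of_fourier (equivS H.isK) (equivS H.isK) hq h2 (A := 1) (B := 1)
      (by simp) (by simp) fun x y => ?_,
    nondegenerate_of_fourier (equivS H.isK) (equivT H.isK) hq h2
      -- The factor (-1)^e absorbs the extra sign of the normal value for i even and j odd.
      (A := fun x => (-1) ^ (x.2 : ℕ) * ζ ^ (x.1 : ℕ) / D.gauge δ (2 * x.1) x.2) (B := 1)
      (by simp [hζ, hF]) (by simp) fun x y => ?_,
    nondegenerate_of_fourier (equivT H.isK) (equivS H.isK) hq h2 (A := 1)
      (B := fun x => ζ ^ (x.1 : ℕ) / D.gauge δ (2 * x.1) x.2)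
      (by simp) (by simp [hζ, hF]) fun x y => ?_,
    nondegenerate_of_fourier (equivT H.isK) (equivT H.isK) hq h2
      (A := fun x => ζ ^ (x.1 : ℕ) * α / D.gauge δ (2 * x.1 + 1) x.2)
      (B := fun x => ζ ^ (x.1 : ℕ) / D.gauge δ (2 * x.1 + 1) x.2)
      (by simp [hζ, hα, hF]) (by simp [hζ, hF]) fun x y => ?_⟩
  · rw [← glue_SS (D.w₁ α β) (D.w₂ α β) (D.w₃ α β) (D.w₄ α β), ← coeffR, equivS_coe, equivS_coe,
      H.coeffR_eq, normalValue_ee]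
    simp
  · rw [← glue_ST (D.w₁ α β) (D.w₂ α β) (D.w₃ α β) (D.w₄ α β), ← coeffR, equivS_coe, equivT_coe,
      H.coeffR_eq, normalValue_eo, mo, Nat.mul_mod_right, Pi.one_apply]
    ring
  · rw [← glue_TS (D.w₁ α β) (D.w₂ α β) (D.w₃ α β) (D.w₄ α β), ← coeffR, equivS_coe, equivT_coe,
      H.coeffR_eq, normalValue_oe, mo, Nat.mul_mod_right, Pi.one_apply]
    ring
  · rw [← glue_TT (D.w₁ α β) (D.w₂ α β) (D.w₃ α β) (D.w₄ α β), ← coeffR, equivT_coe, equivT_coe,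
      H.coeffR_eq, normalValue_oo, mo, mo]
    field_simp (disch := exact hF _ _)
    ring

theorem normalValue_zero_left (j f : ℕ) : normalValue α ζ q 0 0 j f = 1 := by
  simp [normalValue]

theorem normalValue_zero_right (i e : ℕ) : normalValue α ζ q i e 0 0 = 1 := by
  simp [normalValue]

/-- The coefficient at (a^{2m}, a^j b^f) depends on j only through q^{m⌊j/2⌋} and the parity of j,
and the power of q is trivial. -/
theorem coeffR_row [NeZero n] (H : D.GaugeParams α β δ c ζ q) {m : ℕ} (hm : q ^ m = 1)
    (g : KGroup n) : D.coeffR α β (a n ^ (2 * m)) g =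
      (bif D.par g then ζ ^ m / D.P (2 * m) else 1) * D.coeffR α β 1 g := by
  obtain ⟨j, -, f, -, rfl⟩ := KGroup.exists_eq g
  have h1 := H.coeffR_eq (2 * m) 0 j f
  have h2 := H.coeffR_eq 0 0 j f
  have hP : D.P 0 = 1 := rfl
  have hq : ∀ j, q ^ (m * j) = 1 := fun j => by rw [pow_mul, hm, one_pow]
  rw [pow_zero, mul_one, gauge_even _ _ rfl] at h1
  rw [pow_zero, pow_zero, mul_one, gauge_even _ _ rfl, hP] at h2
  rw [h1, h2, par_el H.isK]
  rcases Nat.even_or_odd' j with ⟨j, rfl | rfl⟩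
  · simp [normalValue_ee, hq, normalValue_zero_left]
  · simp [normalValue_eo, hq, normalValue_zero_left,
      show (2 * j + 1) % 2 = 1 by omega]

theorem coeffR_col [NeZero n] (H : D.GaugeParams α β δ c ζ q) {m : ℕ} (hm : q ^ m = 1)
    (g : KGroup n) : D.coeffR α β g (a n ^ (2 * m)) =
      (bif D.par g then ζ ^ m / D.P (2 * m) else 1) * D.coeffR α β g 1 := by
  obtain ⟨j, -, f, -, rfl⟩ := KGroup.exists_eq g
  have h1 := H.coeffR_eq j f (2 * m) 0
  have h2 := H.coeffR_eq j f 0 0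
  have hP : D.P 0 = 1 := rfl
  have hq : ∀ j, q ^ (j * m) = 1 := fun j => by rw [mul_comm, pow_mul, hm, one_pow]
  rw [pow_zero, mul_one, gauge_even δ (2 * m) rfl] at h1
  rw [pow_zero, pow_zero, mul_one, gauge_even δ 0 rfl, hP] at h2
  rw [h1, h2, par_el H.isK]
  rcases Nat.even_or_odd' j with ⟨j, rfl | rfl⟩
  · simp [normalValue_ee, hq, normalValue_zero_right]
  · simp [normalValue_oe, hq, normalValue_zero_right,
      show (2 * j + 1) % 2 = 1 by omega]

/-- As q^n = 1, failure of primitivity means q^m = 1 for some 0 < m < n; then a^{2m} ≠ 1 because a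
has order 2n. -/
theorem isPrimitiveRoot_of_forall [NeZero n] (H : D.GaugeParams α β δ c ζ q)
    (h : ∀ m, q ^ m = 1 → a n ^ (2 * m) ≠ 1 → False) : IsPrimitiveRoot q n := by
  refine IsPrimitiveRoot.mk_of_lt q (NeZero.pos n) H.q_pow_n fun m h0 hm hq => h m hq fun ha => ?_
  have := el_injective (n := n) (i := 2 * m) (e := 0) (j := 0) (f := 0) (by omega) (by omega)
    (by omega) (by omega) (by simpa using ha)
  omega

/-- If q^m = 1 with a^{2m} ≠ 1, the rows of w¹ at a^{2m} and at 1 coincide, so w¹ alone already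
detects primitivity. -/
theorem isPrimitiveRoot_of_nondegenerate [NeZero n] (H : D.GaugeParams α β δ c ζ q)
    (hw : (D.w₁ α β).Nondegenerate) : IsPrimitiveRoot q n := by
  refine H.isPrimitiveRoot_of_forall fun m hm ha => ?_
  have hc : D.act (a n ^ (2 * m)) = a n ^ (2 * m) := by
    have := (b_pow_mul_eq_iff H.isK (2 * m) 0).2 (by omega)
    rwa [pow_zero, mul_one] at this
  let s : D.S := ⟨a n ^ (2 * m), hc⟩
  let s₁ : D.S := ⟨1, map_one _⟩
  have hv := hw.separatingLeft.eq_zero_of_vecMul_eq_zero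
    (v := Pi.single s 1 - Pi.single s₁ 1) <| by
      rw [Matrix.sub_vecMul, Matrix.single_one_vecMul, Matrix.single_one_vecMul, sub_eq_zero]
      funext t
      have := H.coeffR_row hm t
      rw [par_S, cond_false, one_mul] at this
      change D.w₁ α β s t = D.w₁ α β s₁ t
      rw [← glue_SS (D.w₁ α β) (D.w₂ α β) (D.w₃ α β) (D.w₄ α β) s t,
        ← glue_SS (D.w₁ α β) (D.w₂ α β) (D.w₃ α β) (D.w₄ α β) s₁ t]
      exact this
  have hne : s ≠ s₁ := fun h => ha (congr_arg Subtype.val h)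
  have := congr_fun hv s
  simp [hne] at this

theorem isPrimitiveRoot_of_minimal [NeZero n] (H : D.GaugeParams α β δ c ζ q)
    (hR : IsMinimalQuasitriangular (D.Rαβ α β)) : IsPrimitiveRoot q n := by
  refine H.isPrimitiveRoot_of_forall fun m hm ha => ?_
  have hc : D.act (a n ^ (2 * m)) = a n ^ (2 * m) := by
    have := (b_pow_mul_eq_iff H.isK (2 * m) 0).2 (by omega)
    rwa [pow_zero, mul_one] at this
  -- With σ(a^{2m}) = (-c²)^m P_{2m}², this ω satisfies ω²σ(a^{2m}) = ζ^{2m}(-c²)^m = q^m = 1.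
  refine range_mul_range_ne_top (W := D.coeffR α β) ha hc (ω := ζ ^ m / D.P (2 * m)) ?_
    (H.coeffR_row hm) (H.coeffR_col hm) ?_
  · rw [H.σ_even, ← hm, H.q_pow]
    field_simp
    ring
  · have := hR.2
    rwa [Rαβ, nontrivialForm_eq_parityForm] at this

theorem isUniversalRMatrix [NeZero n] (H : D.GaugeParams α β δ c ζ q) :
    IsUniversalRMatrix (D.Rαβ α β) := by
  rw [Rαβ, nontrivialForm_eq_parityForm]
  exact isUniversalRMatrix_parityForm H.par_mul H.coeffR_ne_zero H.coeffR_mul_left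
    H.coeffR_mul_right H.coeffR_act

/-- Since P_2 = τ(a,a), the value of σ at a² is -c²τ(a,a)², and the remaining square is ζ². -/
theorem q_eq_main [NeZero n] (H : D.GaugeParams α β δ c ζ q) :
    ((D.σ (a n) : k) * α * β) ^ 2 * (D.σ (a n ^ 2) : k) * ((D.τ (a n) (a n) : k) ^ 2)⁻¹ = q := by
  have h := H.σ_even 1
  have hP : D.P (2 * 1) = D.τ (a n) (a n) := by simp [P]
  rw [hP, mul_one, pow_one] at h
  rw [h, ← H.ζ_eq', H.q_eq]
  field_simp

end GaugeParams
end ExtensionData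

theorem mainTheorem11 {k : Type*} [Field k] [IsAlgClosed k] [CharZero k] (n : ℕ) [NeZero n]
    (D : ExtensionData k (KGroup n)) (hD : D.IsK)
    (hη : D.η (KGroup.a n) (KGroup.b n) = -1)
    (α β : k) (hαβ : D.IsAdmissible α β) :
    (IsMinimalQuasitriangular (D.Rαβ α β) ↔
      (D.w₁ α β).Nondegenerate ∧ (D.w₂ α β).Nondegenerate ∧
        (D.w₃ α β).Nondegenerate ∧ (D.w₄ α β).Nondegenerate) ∧
    (((D.w₁ α β).Nondegenerate ∧ (D.w₂ α β).Nondegenerate ∧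
        (D.w₃ α β).Nondegenerate ∧ (D.w₄ α β).Nondegenerate) ↔
      IsPrimitiveRoot
        (((D.σ (KGroup.a n) : k) * α * β) ^ 2 * (D.σ (KGroup.a n ^ 2) : k) *
          ((D.τ (KGroup.a n) (KGroup.a n) : k) ^ 2)⁻¹) n) := by
  have H := hαβ.gaugeParams hD hη
  rw [H.q_eq_main]
  exact ⟨⟨fun h => H.nondegenerate two_ne_zero (H.isPrimitiveRoot_of_minimal h), fun h =>
      ⟨H.isUniversalRMatrix, ExtensionData.range_mul_range_eq_top h.1 h.2.1 h.2.2.1 h.2.2.2⟩⟩,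
    fun h => H.isPrimitiveRoot_of_nondegenerate h.1, H.nondegenerate two_ne_zero⟩
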